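/- Let $\mathbb{K}$ be an algebraically closed field of characteristic zero, let $n \ge 0$, and let $X = \{f = 0\} \subseteq \mathbb{P}^n$ be the quadric defined by a quadratic form $f \in \mathbb{K}[x_0, \dots, x_n]$ whose rank (the rank of its symmetric matrix) is at least three. Then the complement $Y = \mathbb{P}^n \setminus X$ is an affine variety (an affine integral separated scheme of finite type over $\mathbb{K}$), and $Y$ is flexible: at every smooth (closed) point $y \in Y$ the tangent space $T_yY$ is spanned by the tangent vectors at $y$ to the orbits of $y$ under effective actions of the additive group $\mathbb{G}_\mathrm{a} = (\mathbb{K}, +)$ on $Y$. -/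

import Mathlib

open CategoryTheory AlgebraicGeometry

universe u

noncomputable section

namespace QuadricComplement

section Flexible

variable {K : Type u} [Field K] {X : Scheme.{u}} (p : X ⟶ Spec (CommRingCat.of K))

/-- A variety over `K`: an integral separated scheme of finite type over `K`. -/
structure IsVariety : Prop where
  isIntegral : AlgebraicGeometry.IsIntegral X
  isSeparated : AlgebraicGeometry.IsSeparated p
  locallyOfFiniteType : LocallyOfFiniteType p
  quasiCompact : QuasiCompact p

/-- Given a morphism `α : 𝔸¹ × X ⟶ X`, a `T`-valued point `x` of `X` and a `T`-valued point `s` of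
the affine line (a global function on `T`), the `T`-valued point `α (s, x)` of `X`. -/
def actBy (α : 𝔸(PUnit.{u + 1}; X) ⟶ X) {T : Scheme.{u}} (s : Γ(T, ⊤)) (x : T ⟶ X) : T ⟶ X :=
  AffineSpace.homOfVector x (fun _ => s) ≫ α

/-- An action of the additive group `𝔾ₐ` over `K` on the `K`-scheme `X`: a morphism
`𝔾ₐ × X = 𝔸¹ × X ⟶ X` over `K` which satisfies the axioms of a group action on `T`-valued points
for every `T`. -/
structure GaAction where
  /-- the action morphism -/
  map : 𝔸(PUnit.{u + 1}; X) ⟶ X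
  map_over : map ≫ p = (𝔸(PUnit.{u + 1}; X) ↘ X) ≫ p
  zero_act : ∀ {T : Scheme.{u}} (x : T ⟶ X), actBy map 0 x = x
  add_act : ∀ {T : Scheme.{u}} (s t : Γ(T, ⊤)) (x : T ⟶ X),
    actBy map (s + t) x = actBy map s (actBy map t x)

/-- A constant `c : K` as a global function on `X`. -/
def constSection (c : K) : Γ(X, ⊤) :=
  p.appTop ((Scheme.ΓSpecIso (CommRingCat.of K)).inv c)

variable {p} in
/-- The action is effective: only `0 ∈ 𝔾ₐ(K)` acts as the identity of `X`. -/
def GaAction.IsEffective (α : GaAction p) : Prop :=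
  ∀ c : K, actBy α.map (constSection p c) (𝟙 X) = 𝟙 X → c = 0

/-- The Zariski tangent space `T_x X`, the dual of `𝔪 / 𝔪²`, over the residue field of `x`. -/
abbrev TangentSpace (X : Scheme.{u}) (x : X) : Type u :=
  Module.Dual (IsLocalRing.ResidueField (X.presheaf.stalk x))
    (IsLocalRing.CotangentSpace (X.presheaf.stalk x))

/-- The ring `κ(x)[ε]` of dual numbers over the residue field of `x`. -/
abbrev dualNumbers (X : Scheme.{u}) (x : X) : CommRingCat.{u} :=
  CommRingCat.of (DualNumber (IsLocalRing.ResidueField (X.presheaf.stalk x)))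

/-- The point `x`, seen as a `κ(x)[ε]`-valued point of `X`. -/
def constArc (X : Scheme.{u}) (x : X) : Spec (dualNumbers X x) ⟶ X :=
  Spec.map (CommRingCat.ofHom
    ((TrivSqZeroExt.inlHom (IsLocalRing.ResidueField (X.presheaf.stalk x))
      (IsLocalRing.ResidueField (X.presheaf.stalk x))).comp
        (IsLocalRing.residue (X.presheaf.stalk x)))) ≫ X.fromSpecStalk x

variable {p} in
/-- The first order part `s ↦ α (s, x)`, `s = ε`, of the orbit map of `x`, as a
`κ(x)[ε]`-valued point of `X`. -/
def GaAction.orbitArc (α : GaAction p) (x : X) : Spec (dualNumbers X x) ⟶ X :=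
  actBy α.map ((Scheme.ΓSpecIso (dualNumbers X x)).inv DualNumber.eps) (constArc X x)

/-- The tangent vector `v` at `x` is the one given by the `κ(x)[ε]`-valued point `τ` of `X`:
`τ` is the composite of `Spec κ(x)[ε] ⟶ Spec 𝒪_{X, x} ⟶ X`, and the ring homomorphism
`φ : 𝒪_{X, x} → κ(x)[ε]` is `m ↦ v(m) ε` on the maximal ideal. -/
def IsVelocity {x : X} (v : TangentSpace X x) (τ : Spec (dualNumbers X x) ⟶ X) : Prop :=
  ∃ φ : X.presheaf.stalk x ⟶ dualNumbers X x,
    τ = Spec.map φ ≫ X.fromSpecStalk x ∧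
    ∀ m : IsLocalRing.maximalIdeal (X.presheaf.stalk x),
      φ.hom (m : X.presheaf.stalk x) =
        TrivSqZeroExt.inr (v ((IsLocalRing.maximalIdeal (X.presheaf.stalk x)).toCotangent m))

/-- The point `x` is flexible: `T_x X` is spanned by the tangent vectors at `x` to the orbits of
`x` under effective `𝔾ₐ`-actions on `X`. -/
def IsFlexibleAt (x : X) : Prop :=
  Submodule.span (IsLocalRing.ResidueField (X.presheaf.stalk x))
    {v : TangentSpace X x | ∃ α : GaAction p, α.IsEffective ∧ IsVelocity v (α.orbitArc x)} = ⊤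

/-- `x` is a smooth point of `X` over `K`. -/
def IsSmoothPoint (x : X) : Prop :=
  ∃ U : X.Opens, x ∈ U ∧ Smooth (U.ι ≫ p)

/-- `X` is flexible: every smooth (closed) point of `X` is flexible. -/
def IsFlexible : Prop :=
  ∀ x : X, IsClosed ({x} : Set X) → IsSmoothPoint p x → IsFlexibleAt p x

end Flexible

section Quadric

attribute [local instance] MvPolynomial.gradedAlgebra

variable (K : Type u) [Field K] (n : ℕ)

/-- Projective space `ℙⁿ` over `K`, as `Proj K[x₀, …, xₙ]`. -/
abbrev projectiveSpace : Scheme.{u} :=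
  Proj (MvPolynomial.homogeneousSubmodule (Fin (n + 1)) K)

/-- The structure morphism `ℙⁿ ⟶ Spec K`. -/
def projectiveSpaceToSpec : projectiveSpace K n ⟶ Spec (CommRingCat.of K) :=
  Proj.toSpecZero (MvPolynomial.homogeneousSubmodule (Fin (n + 1)) K) ≫
    Spec.map (CommRingCat.ofHom
      (algebraMap K (MvPolynomial.homogeneousSubmodule (Fin (n + 1)) K 0)))

variable {K n}

/-- The symmetric matrix of a quadratic form `f = ∑ᵢⱼ aᵢⱼ xᵢ xⱼ` with `aᵢⱼ = aⱼᵢ`. -/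
def gramMatrix (f : MvPolynomial (Fin (n + 1)) K) : Matrix (Fin (n + 1)) (Fin (n + 1)) K :=
  Matrix.of fun i j =>
    (if i = j then 1 else 1 / 2) * f.coeff (Finsupp.single i 1 + Finsupp.single j 1)

/-- The rank of the quadric `f = 0`. -/
def quadricRank (f : MvPolynomial (Fin (n + 1)) K) : ℕ := (gramMatrix f).rank

/-- The zero locus of `f` in `ℙⁿ`. -/
def quadric (f : MvPolynomial (Fin (n + 1)) K) : Set (projectiveSpace K n) :=
  ProjectiveSpectrum.zeroLocus (MvPolynomial.homogeneousSubmodule (Fin (n + 1)) K) {f}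

/-- The open subscheme `ℙⁿ ∖ X` for the zero locus `X` of `f`. -/
def complement (f : MvPolynomial (Fin (n + 1)) K) : (projectiveSpace K n).Opens :=
  ⟨(quadric f)ᶜ, (ProjectiveSpectrum.isClosed_zeroLocus _ _).isOpen_compl⟩

/-- The structure morphism `ℙⁿ ∖ X ⟶ Spec K`. -/
def complementToSpec (f : MvPolynomial (Fin (n + 1)) K) :
    (complement f).toScheme ⟶ Spec (CommRingCat.of K) :=
  (complement f).ι ≫ projectiveSpaceToSpec K n

end Quadric

end QuadricComplement

end

/-!
# Flexibility of the complement of a quadric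

The complement `Y` of the quadric `f = 0` is the spectrum of the ring `R` of fractions `p / fᵏ` of
degree zero. It is a domain of finite type over `K`, because it is a subring of `K[x]_f`.

Let `β` be the bilinear form with `β(x, x) = f(x)`. If `u` is isotropic and `w` is orthogonal to
`u`, then `x ↦ β(u, x) w - β(w, x) u` is nilpotent and skew, and its exponentials, the Eichler
transformations, are a one-parameter group of linear maps which preserve `f` (`baseForm_eichler`,
`eichler_add`). This covers degenerate forms as well, since `w` may lie in the radical. The group
acts on `K[x]_f`, its coaction `K[x]_f → K[x]_f[t]` maps `R` into `R[t]` because the substitution is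
linear in `x` (`IsDegreeZeroPart.exists_eichlerCoaction`), and a coaction on `R` is the same as a
`𝔾ₐ`-action on `Y` (`GaCoaction.toAction`). An action with a nonzero velocity somewhere is effective
in characteristic zero (`GaCoaction.isEffective_toAction`), so that effectiveness costs nothing.

A closed point of `Y` is represented by a vector `v` with `f(v) = 1`
(`IsDegreeZeroPart.exists_vector`). Suppose that the cotangent vector at `v` of `r = p / fᵏ` is killed
by the velocities of all these actions. Then the differential of `p` at `v` is a linear form which
vanishes at `v`, by Euler's identity, and at all vectors `β(u, v) w - β(w, v) u`. For `e` orthogonal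
to `v` with `β(e, e) = -1` the vector `u = v + e` is isotropic, and the condition for this `u` says
that the linear form is a multiple of `β(e, ·)`. As the rank is at least three, there are two
orthogonal vectors `e` of this kind, and the linear form is zero (`eq_zero_of_eichler_velocity`). So
`p` vanishes to second order at `v`, and by Taylor's formula `r` lies in the square of the maximal
ideal after multiplication with a function that does not vanish at the point
(`IsDegreeZeroPart.exists_mul_mem_sq`). By duality the velocities span the tangent space
(`isFlexible_of_coactions`).
-/


noncomputable section

namespace QuadricComplement

section Polynomials

open Polynomial

/-! ### Coactions of the additive group on a ring -/

/-- A coaction of the additive group on the `K`-algebra `R`: a `K`-algebra homomorphism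
`R → R[t]` whose value `ρ r` is thought of as the function `t ↦ t · r`. In `coassoc` the outer
variable of `R[X][X]` is the group element that acts last. -/
structure GaCoaction (K R : Type*) [CommRing K] [CommRing R] [Algebra K R] where
  /-- the coaction homomorphism -/
  toAlgHom : R →ₐ[K] R[X]
  eval_zero : ∀ r, (toAlgHom r).eval 0 = r
  coassoc : ∀ r, (toAlgHom r).map (toAlgHom : R →+* R[X]) =
    (toAlgHom r).eval₂ ((C : R[X] →+* R[X][X]).comp C) (X + C X)

namespace GaCoaction

variable {K R : Type*} [CommRing K] [CommRing R] [Algebra K R] (ρ : GaCoaction K R)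

/-- The `B`-valued point `s · x`, for a `B`-valued point `x` of `Spec R` and `s : B`. -/
def act {B : Type*} [CommRing B] (s : B) (x : R →+* B) : R →+* B :=
  (eval₂RingHom x s).comp (ρ.toAlgHom : R →+* R[X])

lemma act_apply {B : Type*} [CommRing B] (s : B) (x : R →+* B) (r : R) :
    ρ.act s x r = (ρ.toAlgHom r).eval₂ x s := rfl

lemma zero_act {B : Type*} [CommRing B] (x : R →+* B) : ρ.act 0 x = x := by
  ext r
  rw [act_apply, eval₂_at_zero, coeff_zero_eq_eval_zero, ρ.eval_zero]

lemma add_act {B : Type*} [CommRing B] (s t : B) (x : R →+* B) :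
    ρ.act (s + t) x = ρ.act s (ρ.act t x) := by
  ext r
  have h := congrArg (eval₂ (eval₂RingHom x t) s) (ρ.coassoc r)
  rw [eval₂_map] at h
  rw [act_apply, act_apply]
  refine Eq.trans ?_ h.symm
  rw [← coe_eval₂RingHom (eval₂RingHom x t), hom_eval₂]
  congr 1
  · ext; simp
  · simp

/-- In characteristic zero, a coaction for which some `c ≠ 0` acts trivially is trivial: all
multiples of `c` then act trivially, so that `ρ r - r` has infinitely many roots. -/
lemma toAlgHom_eq_C_of_act_eq_id {K R : Type*} [Field K] [CharZero K] [CommRing R] [IsDomain R]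
    [Algebra K R] (ρ : GaCoaction K R) {c : K} (hc : c ≠ 0)
    (h : ρ.act (algebraMap K R c) (RingHom.id R) = RingHom.id R) (r : R) :
    ρ.toAlgHom r = C r := by
  have key : ∀ m : ℕ, ρ.act (algebraMap K R (m * c)) (RingHom.id R) = RingHom.id R := by
    intro m
    induction m with
    | zero => simpa using ρ.zero_act (RingHom.id R)
    | succ m ih =>
      rw [Nat.cast_succ, add_mul, one_mul, map_add, add_act, h, ih]
  apply eq_of_infinite_eval_eq
  refine (Set.infinite_range_of_injective
    (f := fun m : ℕ => algebraMap K R (m * c)) ?_).mono ?_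
  · intro a b hab
    have := (algebraMap K R).injective hab
    exact_mod_cast mul_right_cancel₀ hc this
  · rintro _ ⟨m, rfl⟩
    have := congrArg (fun g : R →+* R => g r) (key m)
    simpa [act_apply, eval₂_id] using this

end GaCoaction

/-! ### Actions on affine schemes -/

/-- The morphism to an affine scheme given by a ring homomorphism on global functions. -/
def homToAffine {X T : Scheme.{u}} [IsAffine X] (φ : Γ(X, ⊤) →+* Γ(T, ⊤)) : T ⟶ X :=
  T.toSpecΓ ≫ Spec.map (CommRingCat.ofHom φ) ≫ X.isoSpec.inv

lemma homToAffine_appTop {X T : Scheme.{u}} [IsAffine X] (φ : Γ(X, ⊤) →+* Γ(T, ⊤)) :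
    (homToAffine φ).appTop = CommRingCat.ofHom φ := by
  have h : homToAffine φ ≫ X.toSpecΓ = T.toSpecΓ ≫ Spec.map (CommRingCat.ofHom φ) := by
    rw [← Scheme.isoSpec_hom, homToAffine]; simp
  have h2 := congrArg (fun g : T ⟶ Spec Γ(X, ⊤) => (Scheme.ΓSpecIso _).inv ≫ g.appTop) h
  have h3 : (homToAffine φ).appTop = (Scheme.ΓSpecIso Γ(X, ⊤)).inv ≫
      (Scheme.ΓSpecIso (CommRingCat.of ↑Γ(X, ⊤))).hom ≫ CommRingCat.ofHom φ := by
    simpa [Scheme.toSpecΓ_appTop] using h2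
  rw [h3]
  exact Iso.inv_hom_id_assoc _ _

lemma hom_ext_of_appTop {X T : Scheme.{u}} [IsAffine X] {f g : T ⟶ X}
    (h : ∀ r, f.appTop.hom r = g.appTop.hom r) : f = g :=
  ext_of_isAffine (by ext r; exact h r)

section Action

variable {K : Type u} [Field K] {X : Scheme.{u}} [IsAffine X] (p : X ⟶ Spec (CommRingCat.of K))
  [Algebra K Γ(X, ⊤)]

/-- The action morphism `𝔸¹ × X ⟶ X` of a coaction on the ring of functions of `X`. -/
def actionMap (ρ : GaCoaction K Γ(X, ⊤)) : 𝔸(PUnit.{u + 1}; X) ⟶ X :=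
  homToAffine (ρ.act (AffineSpace.coord X PUnit.unit) (𝔸(PUnit.{u + 1}; X) ↘ X).appTop.hom)

lemma actBy_actionMap_appTop (ρ : GaCoaction K Γ(X, ⊤)) {T : Scheme.{u}} (s : Γ(T, ⊤))
    (x : T ⟶ X) : (actBy (actionMap ρ) s x).appTop.hom = ρ.act s x.appTop.hom := by
  ext r
  rw [actBy, Scheme.Hom.comp_appTop, actionMap, homToAffine_appTop]
  simp only [CommRingCat.hom_comp, RingHom.comp_apply, CommRingCat.hom_ofHom,
    GaCoaction.act_apply]
  rw [hom_eval₂]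
  congr 1
  · rw [← CommRingCat.hom_comp, ← Scheme.Hom.comp_appTop, AffineSpace.homOfVector_over]
  · exact AffineSpace.homOfVector_appTop_coord _ _ _

/-- The `𝔾ₐ`-action on the affine scheme `X` given by a coaction on its ring of functions. -/
def GaCoaction.toAction (halg : ∀ c : K, algebraMap K Γ(X, ⊤) c = constSection p c)
    (ρ : GaCoaction K Γ(X, ⊤)) : GaAction p where
  map := actionMap ρ
  map_over := by
    apply hom_ext_of_appTop
    intro z
    obtain ⟨c, rfl⟩ : ∃ c, (Scheme.ΓSpecIso (CommRingCat.of K)).inv.hom c = z :=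
      ⟨(Scheme.ΓSpecIso (CommRingCat.of K)).hom.hom z, by
        rw [← RingHom.comp_apply, ← CommRingCat.hom_comp, Iso.hom_inv_id]; rfl⟩
    have hc : p.appTop.hom ((Scheme.ΓSpecIso (CommRingCat.of K)).inv.hom c) =
      algebraMap K Γ(X, ⊤) c := (halg c).symm
    rw [Scheme.Hom.comp_appTop, Scheme.Hom.comp_appTop]
    simp only [CommRingCat.hom_comp, RingHom.comp_apply]
    rw [hc, actionMap, homToAffine_appTop, CommRingCat.hom_ofHom, GaCoaction.act_apply,
      ρ.toAlgHom.commutes, Polynomial.algebraMap_apply, eval₂_C]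
  zero_act x := hom_ext_of_appTop fun r => by
    rw [actBy_actionMap_appTop, GaCoaction.zero_act]
  add_act s t x := hom_ext_of_appTop fun r => by
    rw [actBy_actionMap_appTop, actBy_actionMap_appTop, actBy_actionMap_appTop,
      GaCoaction.add_act]

variable {p} (halg : ∀ c : K, algebraMap K Γ(X, ⊤) c = constSection p c)

lemma GaCoaction.isEffective_toAction [CharZero K] [IsDomain Γ(X, ⊤)] (ρ : GaCoaction K Γ(X, ⊤))
    {r : Γ(X, ⊤)} (hr : (ρ.toAlgHom r).coeff 1 ≠ 0) : (ρ.toAction p halg).IsEffective := by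
  intro c hc
  by_contra hne
  have h : (actBy (actionMap ρ) (constSection p c) (𝟙 X)).appTop.hom = (𝟙 X : X ⟶ X).appTop.hom :=
    congrArg (fun g : X ⟶ X => g.appTop.hom) hc
  rw [actBy_actionMap_appTop, ← halg] at h
  simp only [Scheme.Hom.id_appTop, CommRingCat.hom_id] at h
  rw [ρ.toAlgHom_eq_C_of_act_eq_id hne h, coeff_C] at hr
  simp at hr

/-- The value of a global function at a point. -/
def valueAt (x : X) : Γ(X, ⊤) →+* IsLocalRing.ResidueField (X.presheaf.stalk x) :=
  (IsLocalRing.residue (X.presheaf.stalk x)).comp (X.presheaf.germ ⊤ x trivial).hom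

lemma ΓSpecIso_specMap_fromSpecStalk_appTop {Y : Scheme.{u}} (x : Y) {S : CommRingCat.{u}}
    (φ : Y.presheaf.stalk x ⟶ S) (r : Γ(Y, ⊤)) :
    (Scheme.ΓSpecIso S).hom.hom ((Spec.map φ ≫ Y.fromSpecStalk x).appTop.hom r) =
      φ.hom ((Y.presheaf.germ ⊤ x trivial).hom r) := by
  have h : (Spec.map φ ≫ Y.fromSpecStalk x).appTop ≫ (Scheme.ΓSpecIso S).hom =
      Y.presheaf.germ ⊤ x trivial ≫ φ := by
    rw [Scheme.Hom.comp_appTop, Category.assoc, Scheme.ΓSpecIso_naturality,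
      Scheme.fromSpecStalk_appTop]
    simp
  rw [← RingHom.comp_apply, ← CommRingCat.hom_comp, h, CommRingCat.hom_comp, RingHom.comp_apply]

/-- Evaluation of a polynomial at `ε` gives its part of order at most one. -/
lemma eval₂_eps {R k : Type*} [CommRing R] [CommRing k] (g : R →+* k) (q : R[X]) :
    q.eval₂ ((TrivSqZeroExt.inlHom k k).comp g) (DualNumber.eps : DualNumber k) =
      TrivSqZeroExt.inl (g (q.coeff 0)) + TrivSqZeroExt.inr (g (q.coeff 1)) := by
  induction q using Polynomial.induction_on' with
  | add p q hp hq =>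
    rw [eval₂_add, hp, hq]
    simp only [coeff_add, map_add, TrivSqZeroExt.inl_add, TrivSqZeroExt.inr_add]
    abel
  | monomial n a =>
    rw [eval₂_monomial]
    match n with
    | 0 => simp
    | 1 =>
      simp only [pow_one, coeff_monomial]
      ext <;> simp
    | n + 2 =>
      have h : (DualNumber.eps : DualNumber k) ^ (n + 2) = 0 := by
        rw [pow_add, pow_two, DualNumber.eps_mul_eps, mul_zero]
      rw [h]
      simp [coeff_monomial]

lemma orbitArc_appTop (ρ : GaCoaction K Γ(X, ⊤)) (x : X) (r : Γ(X, ⊤)) :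
    (Scheme.ΓSpecIso (dualNumbers X x)).hom.hom
      (((ρ.toAction p halg).orbitArc x).appTop.hom r) =
    TrivSqZeroExt.inl (valueAt x r) +
      TrivSqZeroExt.inr (valueAt x ((ρ.toAlgHom r).coeff 1)) := by
  have h0 : (ρ.toAlgHom r).coeff 0 = r := by rw [coeff_zero_eq_eval_zero, ρ.eval_zero]
  have h : ((ρ.toAction p halg).orbitArc x).appTop.hom =
      ρ.act ((Scheme.ΓSpecIso (dualNumbers X x)).inv.hom DualNumber.eps)
        (constArc X x).appTop.hom := actBy_actionMap_appTop _ _ _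
  rw [h, GaCoaction.act_apply, hom_eval₂]
  have h1 : (Scheme.ΓSpecIso (dualNumbers X x)).hom.hom.comp (constArc X x).appTop.hom =
      (TrivSqZeroExt.inlHom _ _).comp (valueAt x) := by
    ext1 r
    exact ΓSpecIso_specMap_fromSpecStalk_appTop x _ r
  have h2 : (Scheme.ΓSpecIso (dualNumbers X x)).hom.hom
      ((Scheme.ΓSpecIso (dualNumbers X x)).inv.hom DualNumber.eps) = DualNumber.eps := by
    rw [← RingHom.comp_apply, ← CommRingCat.hom_comp, Iso.inv_hom_id]; rfl
  rw [h1, h2, eval₂_eps, h0]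

/-- The ideal of global functions that vanish at a point. -/
abbrev idealAt (x : X) : Ideal Γ(X, ⊤) := RingHom.ker (valueAt x)

lemma primeIdealOf_top (x : X) :
    ((isAffineOpen_top X).primeIdealOf ⟨x, trivial⟩).asIdeal = idealAt x := by
  rw [IsAffineOpen.primeIdealOf_eq_map_closedPoint]
  ext r
  change (X.presheaf.germ ⊤ x trivial).hom r ∈ IsLocalRing.maximalIdeal _ ↔ _
  rw [RingHom.mem_ker, valueAt, RingHom.comp_apply, IsLocalRing.residue_eq_zero_iff]

/-- A ring homomorphism from a local ring to the dual numbers over its residue field that lifts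
the residue map is a tangent vector. -/
lemma exists_dual_of_dualNumber {S : Type*} [CommRing S] [IsLocalRing S]
    (φ : S →+* DualNumber (IsLocalRing.ResidueField S))
    (hφ : ∀ s, (φ s).fst = IsLocalRing.residue S s) :
    ∃ v : Module.Dual (IsLocalRing.ResidueField S) (IsLocalRing.CotangentSpace S),
      ∀ m : IsLocalRing.maximalIdeal S,
        φ m = TrivSqZeroExt.inr (v ((IsLocalRing.maximalIdeal S).toCotangent m)) := by
  have hfst : ∀ m : IsLocalRing.maximalIdeal S, (φ m).fst = 0 := fun m => by
    rw [hφ, IsLocalRing.residue_eq_zero_iff]; exact m.2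
  let d : IsLocalRing.maximalIdeal S →ₗ[S] IsLocalRing.ResidueField S :=
    { toFun := fun m => (φ m).snd
      map_add' := fun a b => by simp
      map_smul' := fun s m => by
        simp only [Submodule.coe_smul, smul_eq_mul, map_mul, TrivSqZeroExt.snd_mul, hfst, hφ,
          RingHom.id_apply, Algebra.smul_def]
        simp }
  have hd : ∀ a b : IsLocalRing.maximalIdeal S, d (a * b) = 0 := fun a b => by
    change (φ ((a : S) * b)).snd = 0
    simp [TrivSqZeroExt.snd_mul, hfst]
  refine ⟨(Ideal.Cotangent.lift d hd).extendScalarsOfSurjective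
    IsLocalRing.residue_surjective, fun m => ?_⟩
  have : Ideal.Cotangent.lift d hd ((IsLocalRing.maximalIdeal S).toCotangent m) = (φ m).snd :=
    Ideal.Cotangent.lift_toCotangent d hd m
  ext
  · simpa using hfst m
  · rw [TrivSqZeroExt.snd_inr]
    exact this.symm

/-- The velocity at `x` of the action given by a coaction `ρ`: it sends the class of a function
`r` vanishing at `x` to the value at `x` of the linear coefficient of `ρ r`. -/
lemma GaCoaction.exists_isVelocity (ρ : GaCoaction K Γ(X, ⊤)) (x : X) :
    ∃ v : TangentSpace X x, IsVelocity v ((ρ.toAction p halg).orbitArc x) ∧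
      ∀ (r : Γ(X, ⊤)) (m : IsLocalRing.maximalIdeal (X.presheaf.stalk x)),
        (X.presheaf.germ ⊤ x trivial).hom r = m →
        v ((IsLocalRing.maximalIdeal (X.presheaf.stalk x)).toCotangent m) =
          valueAt x ((ρ.toAlgHom r).coeff 1) := by
  let _ := X.presheaf.algebra_section_stalk (U := ⊤) ⟨x, trivial⟩
  have hloc : IsLocalization.AtPrime (X.presheaf.stalk x)
    ((isAffineOpen_top X).primeIdealOf ⟨x, trivial⟩).asIdeal :=
    (isAffineOpen_top X).isLocalization_stalk ⟨x, trivial⟩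
  let ψ : Γ(X, ⊤) →+* dualNumbers X x := (Scheme.ΓSpecIso (dualNumbers X x)).hom.hom.comp
    ((ρ.toAction p halg).orbitArc x).appTop.hom
  have hψ : ∀ r, ψ r = TrivSqZeroExt.inl (valueAt x r) +
      TrivSqZeroExt.inr (valueAt x ((ρ.toAlgHom r).coeff 1)) := orbitArc_appTop halg ρ x
  have hu : ∀ s : ((isAffineOpen_top X).primeIdealOf ⟨x, trivial⟩).asIdeal.primeCompl,
      IsUnit (ψ s) := by
    rintro ⟨s, hs⟩
    have hs' : s ∉ idealAt x := fun h => hs (by rwa [primeIdealOf_top])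
    rw [hψ, TrivSqZeroExt.isUnit_iff_isUnit_fst]
    simpa using hs'
  let φ : X.presheaf.stalk x →+* dualNumbers X x := IsLocalization.lift hu
  have hφ : ∀ r, φ ((X.presheaf.germ ⊤ x trivial).hom r) = ψ r := fun r =>
    IsLocalization.lift_eq hu r
  have hfst : ∀ s, (φ s).fst = IsLocalRing.residue _ s := by
    have : (TrivSqZeroExt.fstHom (IsLocalRing.ResidueField (X.presheaf.stalk x))
        (IsLocalRing.ResidueField (X.presheaf.stalk x))
        (IsLocalRing.ResidueField (X.presheaf.stalk x))).toRingHom.comp φ =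
        IsLocalRing.residue (X.presheaf.stalk x) := by
      apply IsLocalization.ringHom_ext
        ((isAffineOpen_top X).primeIdealOf ⟨x, trivial⟩).asIdeal.primeCompl
      ext r
      change (φ ((X.presheaf.germ ⊤ x trivial).hom r)).fst = valueAt x r
      rw [hφ, hψ]; simp
    exact fun s => congrArg (fun g : _ →+* _ => g s) this
  obtain ⟨v, hv⟩ := exists_dual_of_dualNumber φ hfst
  refine ⟨v, ⟨CommRingCat.ofHom φ, ?_, hv⟩, fun r m hm => ?_⟩
  · apply hom_ext_of_appTop
    intro r
    apply (Scheme.ΓSpecIso (dualNumbers X x)).commRingCatIsoToRingEquiv.injective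
    refine Eq.trans ?_ (ΓSpecIso_specMap_fromSpecStalk_appTop x _ r).symm
    exact (hφ r).symm
  · have h1 := hv m
    rw [← hm, hφ, hψ] at h1
    simpa using (congrArg TrivSqZeroExt.snd h1).symm

/-- A criterion for flexibility of an affine variety in terms of its ring of functions: at every
closed point, the differentials of the coactions have no common zero in the cotangent space. -/
theorem isFlexible_of_coactions [CharZero K] [IsDomain Γ(X, ⊤)] [IsNoetherianRing Γ(X, ⊤)]
    (halg : ∀ c : K, algebraMap K Γ(X, ⊤) c = constSection p c)
    (H : ∀ I : Ideal Γ(X, ⊤), I.IsMaximal → ∀ r ∈ I,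
      (∀ ρ : GaCoaction K Γ(X, ⊤), (ρ.toAlgHom r).coeff 1 ∈ I) → ∃ s ∉ I, s * r ∈ I ^ 2) :
    IsFlexible p := by
  intro x hx _
  let _ := X.presheaf.algebra_section_stalk (U := ⊤) ⟨x, trivial⟩
  have hloc : IsLocalization.AtPrime (X.presheaf.stalk x)
    ((isAffineOpen_top X).primeIdealOf ⟨x, trivial⟩).asIdeal :=
    (isAffineOpen_top X).isLocalization_stalk ⟨x, trivial⟩
  have hmax : (idealAt x).IsMaximal := by
    rw [← primeIdealOf_top]
    exact (isAffineOpen_top X).primeIdealOf_isMaximal_of_isClosed ⟨x, trivial⟩ hx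
  have hnoeth : IsNoetherianRing (X.presheaf.stalk x) := IsLocalization.isNoetherianRing
    ((isAffineOpen_top X).primeIdealOf ⟨x, trivial⟩).asIdeal.primeCompl _ inferInstance
  have hunit : ∀ s ∉ idealAt x, IsUnit ((X.presheaf.germ ⊤ x trivial).hom s) := fun s hs =>
    IsLocalization.map_units (X.presheaf.stalk x)
      (⟨s, by rwa [← primeIdealOf_top] at hs⟩ :
        ((isAffineOpen_top X).primeIdealOf ⟨x, trivial⟩).asIdeal.primeCompl)
  have hmem : ∀ r, (X.presheaf.germ ⊤ x trivial).hom r ∈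
      IsLocalRing.maximalIdeal (X.presheaf.stalk x) ↔ r ∈ idealAt x := fun r => by
    rw [RingHom.mem_ker, valueAt, RingHom.comp_apply, IsLocalRing.residue_eq_zero_iff]
  -- by duality it suffices that no nonzero cotangent vector `ξ` is killed by all velocities
  rw [IsFlexibleAt, ← Subspace.dualCoannihilator_dualAnnihilator_eq
    (W := Submodule.span _ {v : TangentSpace X x | _})]
  rw [Submodule.dualAnnihilator_eq_top_iff, eq_bot_iff]
  intro ξ hξ
  obtain ⟨m, rfl⟩ := Ideal.toCotangent_surjective _ ξ
  obtain ⟨⟨r, s⟩, hrs⟩ := IsLocalization.surj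
    ((isAffineOpen_top X).primeIdealOf ⟨x, trivial⟩).asIdeal.primeCompl (m : X.presheaf.stalk x)
  have hs : (s : Γ(X, ⊤)) ∉ idealAt x := by rw [← primeIdealOf_top]; exact s.2
  replace hrs : (m : X.presheaf.stalk x) * (X.presheaf.germ ⊤ x trivial).hom s =
    (X.presheaf.germ ⊤ x trivial).hom r := hrs
  have hr : r ∈ idealAt x := by
    rw [← hmem, ← hrs]; exact Ideal.mul_mem_right _ _ m.2
  -- a coaction with nonzero velocity on `r` is effective, hence its velocity kills `ξ`
  obtain ⟨t, ht, htr⟩ := H (idealAt x) hmax r hr fun ρ => by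
    by_contra hne
    obtain ⟨v, hv, hv'⟩ := ρ.exists_isVelocity halg x
    have h0 : v ((IsLocalRing.maximalIdeal (X.presheaf.stalk x)).toCotangent m) = 0 :=
      (Submodule.mem_dualCoannihilator _).1 hξ v (Submodule.subset_span
        ⟨_, ρ.isEffective_toAction halg fun h => hne (by rw [h]; exact zero_mem _), hv⟩)
    apply hne
    rw [RingHom.mem_ker, ← hv' r ((X.presheaf.germ ⊤ x trivial).hom s • m)
      (by rw [← hrs, Submodule.coe_smul, smul_eq_mul, mul_comm]), map_smul,
      ← IsScalarTower.algebraMap_smul (IsLocalRing.ResidueField (X.presheaf.stalk x)), map_smul,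
      h0, smul_zero]
  rw [Submodule.mem_bot, Ideal.toCotangent_eq_zero]
  have h1 : (X.presheaf.germ ⊤ x trivial).hom (t * r) ∈
      IsLocalRing.maximalIdeal (X.presheaf.stalk x) ^ 2 := by
    have h2 := Ideal.mem_map_of_mem (X.presheaf.germ ⊤ x trivial).hom htr
    rw [Ideal.map_pow] at h2
    exact Ideal.pow_right_mono (J := IsLocalRing.maximalIdeal (X.presheaf.stalk x))
      (Ideal.map_le_iff_le_comap.2 fun a ha => (hmem a).2 ha) 2 h2
  rw [map_mul, ← hrs] at h1
  exact (Ideal.mul_unit_mem_iff_mem _ (hunit s hs)).1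
    ((Ideal.unit_mul_mem_iff_mem _ (hunit t ht)).1 h1)

end Action

/-! ### Eichler transformations -/

section Eichler

variable {K : Type*} [Field K] {ι : Type*} {S T : Type*} [CommRing S] [Algebra K S] [CommRing T]
  [Algebra K T]

/-- A vector over `K`, seen as a vector over a `K`-algebra. -/
def baseVec (S : Type*) [CommRing S] [Algebra K S] (u : ι → K) : ι → S :=
  fun i => algebraMap K S (u i)

lemma map_baseVec (g : S →ₐ[K] T) (u : ι → K) : g ∘ baseVec S u = baseVec T u := by
  ext i; simp [baseVec]

variable [Fintype ι] [DecidableEq ι] (G : Matrix ι ι K)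

/-- The bilinear form on `Sⁿ` with the matrix `G` over `K`, for a `K`-algebra `S`. -/
def baseForm (S : Type*) [CommRing S] [Algebra K S] : LinearMap.BilinForm S (ι → S) :=
  Matrix.toBilin' (G.map (algebraMap K S))

/-- The Eichler transformation `y + s (β(u, y) w - β(w, y) u) - s² / 2 β(w, w) β(u, y) u` with
parameter `s`. For `u` isotropic and `w` orthogonal to `u` these form a one-parameter group of
isometries, the exponential of the nilpotent skew map `y ↦ β(u, y) w - β(w, y) u`. -/
def eichler (u w : ι → K) (s : S) (y : ι → S) : ι → S :=
  y + s • (baseForm G S (baseVec S u) y • baseVec S w - baseForm G S (baseVec S w) y • baseVec S u)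
    - (algebraMap K S (1 / 2) * s ^ 2 * baseForm G S (baseVec S w) (baseVec S w) *
      baseForm G S (baseVec S u) y) • baseVec S u

lemma map_baseForm (g : S →ₐ[K] T) (y z : ι → S) :
    g (baseForm G S y z) = baseForm G T (g ∘ y) (g ∘ z) := by
  simp [baseForm, Matrix.toBilin'_apply]

lemma baseForm_baseVec (u w : ι → K) :
    baseForm G S (baseVec S u) (baseVec S w) = algebraMap K S (baseForm G K u w) :=
  (map_baseForm G (Algebra.ofId K S) u w).symm

variable {G} in
lemma baseForm_comm (hG : G.IsSymm) (y z : ι → S) : baseForm G S y z = baseForm G S z y := by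
  simp only [baseForm, Matrix.toBilin'_apply]
  rw [Finset.sum_comm]
  refine Finset.sum_congr rfl fun i _ => Finset.sum_congr rfl fun j _ => ?_
  rw [Matrix.map_apply, Matrix.map_apply, hG.apply]
  ring

lemma map_eichler (g : S →ₐ[K] T) (u w : ι → K) (s : S) (y : ι → S) :
    g ∘ eichler G u w s y = eichler G u w (g s) (g ∘ y) := by
  ext i
  have h1 := map_baseForm G g (baseVec S u) y
  have h2 := map_baseForm G g (baseVec S w) y
  have h3 := map_baseForm G g (baseVec S w) (baseVec S w)
  rw [map_baseVec] at h1 h2 h3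
  simp only [eichler, Function.comp_apply, Pi.add_apply, Pi.sub_apply, Pi.smul_apply, smul_eq_mul,
    map_add, map_sub, map_mul, map_pow, h1, h2, h3, AlgHom.commutes]
  simp [baseVec]

lemma eichler_zero (u w : ι → K) (y : ι → S) : eichler G u w 0 y = y := by
  simp [eichler]

variable {G} {u w : ι → K}

lemma baseForm_eichler_left (hu : baseForm G K u u = 0)
    (huw : baseForm G K u w = 0) (s : S) (y : ι → S) :
    baseForm G S (baseVec S u) (eichler G u w s y) = baseForm G S (baseVec S u) y := by
  have h1 : baseForm G S (baseVec S u) (baseVec S u) = 0 := by rw [baseForm_baseVec, hu, map_zero]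
  have h2 : baseForm G S (baseVec S u) (baseVec S w) = 0 := by rw [baseForm_baseVec, huw, map_zero]
  simp [eichler, h1, h2]

lemma baseForm_eichler_right (hG : G.IsSymm) (huw : baseForm G K u w = 0) (s : S) (y : ι → S) :
    baseForm G S (baseVec S w) (eichler G u w s y) = baseForm G S (baseVec S w) y +
      s * baseForm G S (baseVec S w) (baseVec S w) * baseForm G S (baseVec S u) y := by
  have h2 : baseForm G S (baseVec S w) (baseVec S u) = 0 := by
    rw [baseForm_comm hG, baseForm_baseVec, huw, map_zero]
  simp [eichler, h2]
  ring

lemma baseForm_eichler [CharZero K] (hG : G.IsSymm) (hu : baseForm G K u u = 0)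
    (huw : baseForm G K u w = 0) (s : S) (y : ι → S) :
    baseForm G S (eichler G u w s y) (eichler G u w s y) = baseForm G S y y := by
  have h1 := baseForm_eichler_left hu huw s y
  have h2 := baseForm_eichler_right hG huw s y
  have h3 := baseForm_comm hG y (eichler G u w s y)
  have h4 : baseForm G S y (baseVec S u) = baseForm G S (baseVec S u) y := baseForm_comm hG _ _
  have h5 : baseForm G S y (baseVec S w) = baseForm G S (baseVec S w) y := baseForm_comm hG _ _
  have half : algebraMap K S (1 / 2) * 2 = 1 := by
    rw [← map_ofNat (algebraMap K S) 2, ← map_mul]; simp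
  set z := eichler G u w s y with hz
  have h6 : baseForm G S z z = baseForm G S y z + s * (baseForm G S (baseVec S u) y *
      baseForm G S (baseVec S w) z - baseForm G S (baseVec S w) y * baseForm G S (baseVec S u) z) -
      (algebraMap K S (1 / 2) * s ^ 2 * baseForm G S (baseVec S w) (baseVec S w) *
      baseForm G S (baseVec S u) y) * baseForm G S (baseVec S u) z := by
    conv_lhs => enter [1]; rw [hz]
    simp only [eichler, map_add, map_sub, map_smul, LinearMap.add_apply, LinearMap.sub_apply,
      LinearMap.smul_apply, smul_eq_mul]
  have h7 : baseForm G S y z = baseForm G S y y + s * (baseForm G S (baseVec S u) y *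
      baseForm G S (baseVec S w) y - baseForm G S (baseVec S w) y * baseForm G S (baseVec S u) y) -
      (algebraMap K S (1 / 2) * s ^ 2 * baseForm G S (baseVec S w) (baseVec S w) *
      baseForm G S (baseVec S u) y) * baseForm G S (baseVec S u) y := by
    rw [hz]
    simp only [eichler, map_add, map_sub, map_smul, smul_eq_mul, h4, h5]
  rw [h6, h7, h1, h2]
  linear_combination (-s ^ 2 * baseForm G S (baseVec S w) (baseVec S w) *
    baseForm G S (baseVec S u) y ^ 2) * half

lemma eichler_add [CharZero K] (hG : G.IsSymm) (hu : baseForm G K u u = 0)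
    (huw : baseForm G K u w = 0) (s t : S) (y : ι → S) :
    eichler G u w (s + t) y = eichler G u w s (eichler G u w t y) := by
  have half : algebraMap K S (1 / 2) * 2 = 1 := by
    rw [← map_ofNat (algebraMap K S) 2, ← map_mul]; simp
  have h1 := baseForm_eichler_left hu huw t y
  have h2 := baseForm_eichler_right hG huw t y
  conv_rhs => rw [eichler, h1, h2]
  ext i
  simp only [eichler, Pi.add_apply, Pi.sub_apply, Pi.smul_apply, smul_eq_mul]
  linear_combination (-s * t * baseForm G S (baseVec S w) (baseVec S w) *
    baseForm G S (baseVec S u) y * baseVec S u i) * half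

end Eichler

/-! ### Linear algebra -/

section LinearAlgebra

variable {K : Type*} [Field K] {ι : Type*} [Fintype ι] [DecidableEq ι] {G : Matrix ι ι K}

/-- A symmetric bilinear form of rank at least three does not vanish on the orthogonal complement
of `v` and `e`, where `v` and `e` are orthogonal with `β(v, v) = 1` and `β(e, e) = -1`; also `e = 0`
is allowed. -/
lemma exists_orthogonal_ne_zero [CharZero K] (hG : G.IsSymm) (hrank : 3 ≤ G.rank) {v e : ι → K}
    (hv : baseForm G K v v = 1) (he : e = 0 ∨ baseForm G K e e = -1)
    (hve : baseForm G K v e = 0) :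
    ∃ z, baseForm G K v z = 0 ∧ baseForm G K e z = 0 ∧ baseForm G K z z ≠ 0 := by
  by_contra! H
  have hev : baseForm G K e v = 0 := by rw [baseForm_comm hG, hve]
  -- the orthogonal projection to the complement of `v` and `e`
  let π : (ι → K) → (ι → K) := fun x => x - baseForm G K v x • v + baseForm G K e x • e
  have hπv : ∀ x, baseForm G K v (π x) = 0 := fun x => by simp [π, hv, hve]
  have hπe : ∀ x, baseForm G K e (π x) = 0 := fun x => by
    rcases he with rfl | he
    · simp
    · simp [π, he, hev]
  have hadd : ∀ x y, π (x + y) = π x + π y := fun x y => by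
    simp only [π, map_add, add_smul]; abel
  have hzero : ∀ x y, baseForm G K (π x) (π y) = 0 := fun x y => by
    have h := H (π (x + y)) (hπv _) (hπe _)
    rw [hadd] at h
    simp only [map_add, LinearMap.add_apply, H (π x) (hπv _) (hπe _),
      H (π y) (hπv _) (hπe _), baseForm_comm hG (π y) (π x)] at h
    have h2 : (2 : K) * baseForm G K (π x) (π y) = 0 := by linear_combination h
    simpa using h2
  have hform : ∀ x y, baseForm G K x y =
      baseForm G K v x * baseForm G K v y - baseForm G K e x * baseForm G K e y := fun x y => by
    have h := hzero x y
    have h1 : baseForm G K (π x) (π y) = baseForm G K x (π y) := by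
      conv_lhs => enter [1]; simp only [π]
      simp only [map_add, map_sub, map_smul, LinearMap.add_apply, LinearMap.sub_apply,
        LinearMap.smul_apply, hπv, hπe]
      simp
    rw [h1] at h
    simp only [π, map_add, map_sub, map_smul, smul_eq_mul, baseForm_comm hG x v,
      baseForm_comm hG x e] at h
    linear_combination h
  have hGeq : G = (Matrix.of ![fun i => baseForm G K v (Pi.single i 1),
      fun i => -baseForm G K e (Pi.single i 1)]).transpose *
      Matrix.of ![fun i => baseForm G K v (Pi.single i 1),
        fun i => baseForm G K e (Pi.single i 1)] := by
    ext i j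
    have h := hform (Pi.single i 1) (Pi.single j 1)
    have h0 : baseForm G K (Pi.single i 1) (Pi.single j 1) = G i j := by
      simp [baseForm, Matrix.toBilin'_single]
    rw [h0] at h
    rw [h, Matrix.mul_apply, Fin.sum_univ_two]
    simp
    ring
  have hle : G.rank ≤ 2 := by
    rw [hGeq]
    refine (Matrix.rank_mul_le_right _ _).trans ((Matrix.rank_le_card_height _).trans ?_)
    simp
  omega

/-- In the situation of `exists_orthogonal_ne_zero`, the orthogonal complement contains a vector
with `β(z, z) = -1` if the field is algebraically closed. -/
lemma exists_orthogonal_eq_neg_one [IsAlgClosed K] [CharZero K] (hG : G.IsSymm)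
    (hrank : 3 ≤ G.rank) {v e : ι → K}
    (hv : baseForm G K v v = 1) (he : e = 0 ∨ baseForm G K e e = -1)
    (hve : baseForm G K v e = 0) :
    ∃ z, baseForm G K v z = 0 ∧ baseForm G K e z = 0 ∧ baseForm G K z z = -1 := by
  obtain ⟨z, h1, h2, h3⟩ := exists_orthogonal_ne_zero hG hrank hv he hve
  obtain ⟨c, hc⟩ := IsAlgClosed.exists_pow_nat_eq (-(baseForm G K z z)⁻¹) (n := 2) (by norm_num)
  refine ⟨c • z, by simp [h1], by simp [h2], ?_⟩
  simp only [map_smul, LinearMap.smul_apply, smul_eq_mul]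
  rw [← mul_assoc, ← pow_two, hc]
  field_simp

/-- The tangent space to `{β(y, y) = 1}` at `v` is spanned by the velocities of the Eichler
transformations: dually, a linear form `l` which vanishes at `v` and at all these velocities is
zero. -/
lemma eq_zero_of_eichler_velocity [IsAlgClosed K] [CharZero K] (hG : G.IsSymm)
    (hrank : 3 ≤ G.rank) {v : ι → K} (hv : baseForm G K v v = 1) (l : (ι → K) →ₗ[K] K)
    (hlv : l v = 0)
    (hl : ∀ u w, baseForm G K u u = 0 → baseForm G K u w = 0 →
      l (baseForm G K u v • w - baseForm G K w v • u) = 0) : l = 0 := by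
  -- the vector `v + e` is isotropic, and the part of an arbitrary `y` orthogonal to it may be
  -- taken for `w`
  have key : ∀ e, baseForm G K v e = 0 → baseForm G K e e = -1 →
      ∀ y, l y = -(baseForm G K e y * l e) := by
    intro e hve hee y
    have hev : baseForm G K e v = 0 := by rw [baseForm_comm hG, hve]
    have h := hl (v + e) (y - baseForm G K (v + e) y • v) (by simp [hv, hve, hev, hee])
      (by simp [hv, hev])
    simp only [map_add, map_sub, map_smul, LinearMap.add_apply, LinearMap.sub_apply,
      LinearMap.smul_apply, smul_eq_mul, hv, hev, hlv, baseForm_comm hG y v] at h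
    linear_combination h
  obtain ⟨e, hve, -, hee⟩ := exists_orthogonal_eq_neg_one hG hrank hv (e := 0) (Or.inl rfl)
    (by simp)
  obtain ⟨e', hve', hee', he'⟩ := exists_orthogonal_eq_neg_one hG hrank hv (Or.inr hee) hve
  have h0 : l e' = 0 := by rw [key e hve hee, hee', zero_mul, neg_zero]
  refine LinearMap.ext fun y => ?_
  rw [key e' hve' he', h0, mul_zero, neg_zero, LinearMap.zero_apply]

end LinearAlgebra

/-! ### Coactions on the functions of degree zero -/

/-- A coaction on `L` restricts to a subalgebra `R` if it maps `R` into `R[t]`. -/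
lemma GaCoaction.exists_restrict {K L R : Type*} [CommRing K] [CommRing L] [Algebra K L]
    [CommRing R] [Algebra K R] (ρ : GaCoaction K L) (θ : R →ₐ[K] L)
    (hθ : Function.Injective θ) (h : ∀ r m, (ρ.toAlgHom (θ r)).coeff m ∈ θ.range) :
    ∃ ρ' : GaCoaction K R, ∀ r, (ρ'.toAlgHom r).map (θ : R →+* L) = ρ.toAlgHom (θ r) := by
  have hinj : Function.Injective (mapAlgHom θ) := map_injective (θ : R →+* L) hθ
  have hmem : ∀ r, (ρ.toAlgHom.comp θ) r ∈ (mapAlgHom θ).range := by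
    intro r
    obtain ⟨q, hq⟩ : ∃ q : R[X], q.map (θ : R →+* L) = ρ.toAlgHom (θ r) := by
      rw [← Polynomial.mem_lifts, lifts_iff_coeff_lifts]
      exact fun m => h r m
    exact ⟨q, hq⟩
  let σ : R →ₐ[K] R[X] := ((AlgEquiv.ofInjective (mapAlgHom θ) hinj).symm :
    (mapAlgHom θ).range →ₐ[K] R[X]).comp ((ρ.toAlgHom.comp θ).codRestrict _ hmem)
  have hσ : ∀ r, (σ r).map (θ : R →+* L) = ρ.toAlgHom (θ r) := fun r =>
    congrArg Subtype.val ((AlgEquiv.ofInjective (mapAlgHom θ) hinj).apply_symm_apply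
      ((ρ.toAlgHom.comp θ).codRestrict _ hmem r))
  refine ⟨⟨σ, fun r => hθ ?_, fun r => ?_⟩, hσ⟩
  · have h1 := ρ.eval_zero (θ r)
    rw [← hσ, ← map_zero (θ : R →+* L), eval_map_apply] at h1
    exact h1
  · apply map_injective (mapRingHom (θ : R →+* L)) hinj
    have h1 := ρ.coassoc (θ r)
    rw [← hσ, eval₂_map] at h1
    rw [← coe_mapRingHom (mapRingHom (θ : R →+* L)), hom_eval₂, coe_mapRingHom, Polynomial.map_map]
    rw [Polynomial.map_map] at h1
    have h2 : (mapRingHom (θ : R →+* L)).comp (σ : R →+* R[X]) =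
        (ρ.toAlgHom : L →+* L[X]).comp (θ : R →+* L) := RingHom.ext hσ
    rw [h2, h1]
    congr 1
    · ext; simp
    · simp

section Localization

variable {K : Type*} [Field K] {ι : Type*} {f : MvPolynomial ι K}
  {L : Type*} [CommRing L] [Algebra K L] [Algebra (MvPolynomial ι K) L]
  [IsScalarTower K (MvPolynomial ι K) L] [IsLocalization.Away f L]
  {S : Type*} [CommRing S] [Algebra K S]

/-- Evaluation of the elements of `K[x]_f` at a point where `f` does not vanish. -/
def evalAt (L : Type*) [CommRing L] [Algebra K L] [Algebra (MvPolynomial ι K) L]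
    [IsScalarTower K (MvPolynomial ι K) L] [IsLocalization.Away f L] {y : ι → S}
    (hy : IsUnit (MvPolynomial.aeval y f)) : L →ₐ[K] S :=
  IsLocalization.liftAlgHom (M := Submonoid.powers f) (f := MvPolynomial.aeval y) <| by
    rintro ⟨_, k, rfl⟩
    simpa using hy.pow k

lemma evalAt_algebraMap {y : ι → S} (hy : IsUnit (MvPolynomial.aeval y f))
    (p : MvPolynomial ι K) :
    evalAt L hy (algebraMap _ L p) = MvPolynomial.aeval y p :=
  IsLocalization.lift_eq _ p

variable (K L) in
/-- The generic point of the space, as a vector over `K[x]_f`. -/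
def genericVec : ι → L := fun i => algebraMap (MvPolynomial ι K) L (MvPolynomial.X i)

lemma evalAt_comp_genericVec {y : ι → S} (hy : IsUnit (MvPolynomial.aeval y f)) :
    evalAt L hy ∘ genericVec K L = y := by
  ext i; simp [genericVec, evalAt_algebraMap]

lemma aeval_genericVec (p : MvPolynomial ι K) :
    MvPolynomial.aeval (genericVec K L) p = algebraMap _ L p := by
  have : MvPolynomial.aeval (genericVec K L) = Algebra.algHom K (MvPolynomial ι K) L := by
    apply MvPolynomial.algHom_ext
    intro i
    rw [MvPolynomial.aeval_X]; rfl
  rw [this]; rfl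

lemma algHom_ext_genericVec (f : MvPolynomial ι K) [IsLocalization.Away f L] {g h : L →ₐ[K] S}
    (H : g ∘ (genericVec K L : ι → L) = h ∘ (genericVec K L : ι → L)) : g = h := by
  apply IsLocalization.algHom_ext (Submonoid.powers f)
  apply MvPolynomial.algHom_ext
  intro i
  exact congrFun H i

lemma isUnit_aeval_C_genericVec :
    IsUnit (MvPolynomial.aeval (fun i => C (genericVec K L i)) f : L[X]) := by
  have h : (MvPolynomial.aeval (fun i => C (genericVec K L i)) f : L[X]) =
      CAlgHom (R := K) (MvPolynomial.aeval (genericVec K L) f) := by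
    rw [MvPolynomial.comp_aeval_apply]
    rfl
  rw [h, aeval_genericVec]
  exact (IsLocalization.Away.algebraMap_isUnit f).map _

variable [Fintype ι] [DecidableEq ι] {G : Matrix ι ι K}

lemma aeval_eq_baseForm (hGf : baseForm G (MvPolynomial ι K) MvPolynomial.X MvPolynomial.X = f)
    (y : ι → S) : MvPolynomial.aeval y f = baseForm G S y y := by
  rw [← hGf, map_baseForm]
  congr 2 <;> · ext i; simp

variable [CharZero K]

lemma isUnit_aeval_eichler (hG : G.IsSymm)
    (hGf : baseForm G (MvPolynomial ι K) MvPolynomial.X MvPolynomial.X = f)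
    {u w : ι → K} (hu : baseForm G K u u = 0) (huw : baseForm G K u w = 0) (s : S) {y : ι → S}
    (hy : IsUnit (MvPolynomial.aeval y f)) :
    IsUnit (MvPolynomial.aeval (eichler G u w s y) f) := by
  rw [aeval_eq_baseForm hGf, baseForm_eichler hG hu huw, ← aeval_eq_baseForm hGf]
  exact hy

variable (L) in
/-- The coaction on `K[x]_f` of a one-parameter group of Eichler transformations. -/
def eichlerCoaction (hG : G.IsSymm)
    (hGf : baseForm G (MvPolynomial ι K) MvPolynomial.X MvPolynomial.X = f)
    {u w : ι → K} (hu : baseForm G K u u = 0) (huw : baseForm G K u w = 0) : GaCoaction K L :=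
  let E : L →ₐ[K] L[X] := evalAt L (isUnit_aeval_eichler hG hGf hu huw (X : L[X])
    (isUnit_aeval_C_genericVec (f := f) (L := L)))
  have hE : E ∘ genericVec K L = eichler G u w X (C ∘ genericVec K L) := evalAt_comp_genericVec _
  { toAlgHom := E
    eval_zero := by
      let ev : L[X] →ₐ[K] L := (aeval (0 : L)).restrictScalars K
      have h : ev.comp E = AlgHom.id K L := by
        apply algHom_ext_genericVec f
        rw [AlgHom.coe_comp, Function.comp_assoc, hE, map_eichler]
        have h1 : ev X = 0 := by simp [ev]
        rw [h1, eichler_zero]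
        ext i
        simp [ev]
      intro r
      have h2 : aeval (0 : L) (E r) = r := congrArg (fun g : L →ₐ[K] L => g r) h
      rwa [coe_aeval_eq_eval] at h2
    coassoc := by
      let Δ : L[X] →ₐ[K] L[X][X] :=
        { eval₂RingHom ((C : L[X] →+* L[X][X]).comp C) (X + C X) with
          commutes' := fun c => by simp [Polynomial.algebraMap_apply] }
      have h : (mapAlgHom E).comp E = Δ.comp E := by
        apply algHom_ext_genericVec f
        rw [AlgHom.coe_comp, Function.comp_assoc, hE, map_eichler, AlgHom.coe_comp,
          Function.comp_assoc, hE, map_eichler]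
        have h1 : mapAlgHom E X = X := by simp
        have h2 : Δ X = X + C X := by simp [Δ]
        have h3 : mapAlgHom E ∘ C ∘ (genericVec K L : ι → L) =
            CAlgHom (R := K) ∘ E ∘ (genericVec K L : ι → L) := by
          ext1 i; simp
        have h4 : Δ ∘ C ∘ (genericVec K L : ι → L) =
            CAlgHom (R := K) ∘ C ∘ (genericVec K L : ι → L) := by
          ext1 i; simp [Δ]
        rw [h1, h2, h3, h4, hE, map_eichler, eichler_add hG hu huw]
        rfl
      intro r
      exact congrArg (fun g : L →ₐ[K] L[X][X] => g r) h }

lemma eichlerCoaction_apply_genericVec (hG : G.IsSymm)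
    (hGf : baseForm G (MvPolynomial ι K) MvPolynomial.X MvPolynomial.X = f)
    {u w : ι → K} (hu : baseForm G K u u = 0) (huw : baseForm G K u w = 0) :
    (eichlerCoaction L hG hGf hu huw).toAlgHom ∘ genericVec K L =
      eichler G u w X (C ∘ genericVec K L) :=
  evalAt_comp_genericVec (isUnit_aeval_eichler hG hGf hu huw _ isUnit_aeval_C_genericVec)

end Localization

/-! ### Polynomials with homogeneous coefficients -/

section Homogeneous

variable {K : Type*} [Field K] {ι : Type*} (L : Type*) [CommRing L] [Algebra K L]
  [Algebra (MvPolynomial ι K) L] [IsScalarTower K (MvPolynomial ι K) L]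

variable (K ι) in
/-- The polynomials over `L` all of whose coefficients come from forms of degree `d`. -/
def formPolys (d : ℕ) : Submodule K L[X] where
  carrier := {q | ∀ m, ∃ p : MvPolynomial ι K, p.IsHomogeneous d ∧ algebraMap _ L p = q.coeff m}
  add_mem' {a b} ha hb m := by
    obtain ⟨p, hp, h1⟩ := ha m
    obtain ⟨q, hq, h2⟩ := hb m
    exact ⟨p + q, hp.add hq, by rw [map_add, h1, h2, coeff_add]⟩
  zero_mem' m := ⟨0, MvPolynomial.isHomogeneous_zero _ _ _, by simp⟩
  smul_mem' c q hq m := by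
    obtain ⟨p, hp, h⟩ := hq m
    refine ⟨c • p, (MvPolynomial.homogeneousSubmodule ι K d).smul_mem c hp, ?_⟩
    rw [coeff_smul, ← h, Algebra.smul_def, map_mul, ← IsScalarTower.algebraMap_apply,
      Algebra.smul_def]

instance : SetLike.GradedMonoid (formPolys K ι L) where
  one_mem m := by
    rw [coeff_one]
    split_ifs
    · exact ⟨1, MvPolynomial.isHomogeneous_one _ _, map_one _⟩
    · exact ⟨0, MvPolynomial.isHomogeneous_zero _ _ _, map_zero _⟩
  mul_mem {i j} a b ha hb m := by
    choose p hp hpa using ha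
    choose q hq hqb using hb
    refine ⟨∑ x ∈ Finset.HasAntidiagonal.antidiagonal m, p x.1 * q x.2,
      MvPolynomial.IsHomogeneous.sum _ _ _ fun x _ => (hp x.1).mul (hq x.2), ?_⟩
    rw [coeff_mul, map_sum]
    exact Finset.sum_congr rfl fun x _ => by rw [map_mul, hpa, hqb]

variable {L} in
lemma aeval_mem_formPolys {y : ι → L[X]} (hy : ∀ i, y i ∈ formPolys K ι L 1) {d : ℕ}
    {p : MvPolynomial ι K} (hp : p.IsHomogeneous d) :
    MvPolynomial.aeval y p ∈ formPolys K ι L d := by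
  rw [MvPolynomial.as_sum p, map_sum]
  refine Submodule.sum_mem _ fun e he => ?_
  rw [MvPolynomial.aeval_monomial, ← Algebra.smul_def]
  refine Submodule.smul_mem _ _ ?_
  have h := SetLike.prod_pow_mem_graded (formPolys K ι L) (fun _ : ι => 1) y (F := e.support) e
    fun i _ => hy i
  have hd : ∑ k ∈ e.support, e k • 1 = d := by
    have := hp (MvPolynomial.mem_support_iff.1 he)
    rw [Finsupp.weight_apply] at this
    simpa [Finsupp.sum] using this
  rwa [hd] at h

end Homogeneous

/-! ### Taylor expansion -/

section Taylor

variable {K : Type*} [Field K] {ι : Type*} [Fintype ι]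

/-- The linear coefficient of a polynomial along a curve. -/
lemma coeff_one_aeval (y : ι → K[X]) (p : MvPolynomial ι K) :
    (MvPolynomial.aeval y p).coeff 1 =
      ∑ i, MvPolynomial.aeval (fun j => (y j).coeff 0) (MvPolynomial.pderiv i p) *
        (y i).coeff 1 := by
  classical
  have h0 : ∀ p : MvPolynomial ι K, (MvPolynomial.aeval y p).coeff 0 =
      MvPolynomial.aeval (fun j => (y j).coeff 0) p := fun p => by
    have := MvPolynomial.comp_aeval_apply (aeval (R := K) (0 : K)) (f := y) p
    simpa [coeff_zero_eq_eval_zero] using this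
  induction p using MvPolynomial.induction_on with
  | C a => simp [MvPolynomial.algHom_C]
  | add p q hp hq => simp [hp, hq, add_mul, Finset.sum_add_distrib]
  | mul_X p i hp =>
    rw [map_mul, MvPolynomial.aeval_X, mul_coeff_one, hp, h0]
    simp only [Derivation.leibniz, MvPolynomial.pderiv_X, smul_eq_mul, map_add, map_mul,
      MvPolynomial.aeval_X, add_mul, Finset.sum_add_distrib]
    congr 1
    · rw [Finset.sum_eq_single i (fun j _ hj => by simp [hj.symm]) (by simp)]
      simp
    · rw [Finset.sum_mul]
      exact Finset.sum_congr rfl fun j _ => by ring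

/-- Taylor expansion to first order modulo the square of an ideal. -/
lemma aeval_sub_taylor_mem_sq {R : Type*} [CommRing R] [Algebra K R] (I : Ideal R) (v : ι → K)
    (y : ι → R) (hy : ∀ i, y i - algebraMap K R (v i) ∈ I) (p : MvPolynomial ι K) :
    MvPolynomial.aeval y p - algebraMap K R (MvPolynomial.aeval v p) -
      ∑ i, algebraMap K R (MvPolynomial.aeval v (MvPolynomial.pderiv i p)) *
        (y i - algebraMap K R (v i)) ∈ I ^ 2 := by
  classical
  induction p using MvPolynomial.induction_on with
  | C a => simp
  | add p q hp hq =>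
    convert add_mem hp hq using 1
    simp only [map_add, add_mul, Finset.sum_add_distrib]
    ring
  | mul_X p i hp =>
    have h1 : ∑ j, algebraMap K R (MvPolynomial.aeval v (MvPolynomial.pderiv j p)) *
        (y j - algebraMap K R (v j)) ∈ I :=
      sum_mem fun j _ => Ideal.mul_mem_left _ _ (hy j)
    have h2 := add_mem (Ideal.mul_mem_right (y i) _ hp) (pow_two I ▸ Ideal.mul_mem_mul h1 (hy i))
    convert h2 using 1
    simp only [Derivation.leibniz, MvPolynomial.pderiv_X, smul_eq_mul, map_add, map_mul,
      MvPolynomial.aeval_X, add_mul, Finset.sum_add_distrib]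
    rw [Finset.sum_eq_single i (fun j _ hj => by simp [hj.symm]) (by simp)]
    simp only [Pi.single_eq_same, map_one, mul_one]
    have h3 : ∑ j, algebraMap K R (v i) *
        algebraMap K R (MvPolynomial.aeval v (MvPolynomial.pderiv j p)) *
        (y j - algebraMap K R (v j)) = algebraMap K R (v i) *
        ∑ j, algebraMap K R (MvPolynomial.aeval v (MvPolynomial.pderiv j p)) *
        (y j - algebraMap K R (v j)) := by
      rw [Finset.mul_sum]
      exact Finset.sum_congr rfl fun j _ => by ring
    rw [h3]
    ring

end Taylor

lemma aeval_smul_of_isHomogeneous {K ι R : Type*} [CommRing K] [CommRing R] [Algebra K R] {d : ℕ}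
    {p : MvPolynomial ι K} (hp : p.IsHomogeneous d) (c : R) (y : ι → R) :
    MvPolynomial.aeval (c • y) p = c ^ d * MvPolynomial.aeval y p := by
  rw [MvPolynomial.as_sum p, map_sum, map_sum, Finset.mul_sum]
  refine Finset.sum_congr rfl fun e he => ?_
  have hd : ∑ k ∈ e.support, e k = d := by
    have := hp (MvPolynomial.mem_support_iff.1 he)
    rw [Finsupp.weight_apply] at this
    simpa [Finsupp.sum] using this
  simp only [MvPolynomial.aeval_monomial, Finsupp.prod, Pi.smul_apply, smul_eq_mul, mul_pow,
    Finset.prod_mul_distrib, Finset.prod_pow_eq_pow_sum, hd]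
  ring

/-! ### The functions on the complement of a quadric -/

/-- `θ` identifies `R` with the ring of fractions `p / fᵏ` with `p` a form of degree `2k`, the part
of degree zero of `K[x]_f` for a form `f` of degree two. -/
structure IsDegreeZeroPart {K R L ι : Type*} [Field K] [CommRing R] [Algebra K R] [CommRing L]
    [Algebra K L] [Algebra (MvPolynomial ι K) L] (f : MvPolynomial ι K) (θ : R →ₐ[K] L) : Prop where
  injective : Function.Injective θ
  mem_range_iff : ∀ z, z ∈ θ.range ↔ ∃ (k : ℕ) (p : MvPolynomial ι K), p.IsHomogeneous (2 * k) ∧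
    z * algebraMap _ L f ^ k = algebraMap _ L p

section

variable {K : Type*} [Field K] {ι : Type*} {f : MvPolynomial ι K}
  {L : Type*} [CommRing L] [Algebra K L] [Algebra (MvPolynomial ι K) L]
  {R : Type*} [CommRing R] [Algebra K R] {θ : R →ₐ[K] L}

/-- Identities in `R` may be checked after multiplication with a power of `f`, which is a unit. -/
lemma IsDegreeZeroPart.eq_of_mul_eq [IsLocalization.Away f L] (hθ : IsDegreeZeroPart f θ)
    {a b : R} (k : ℕ)
    (h : θ a * algebraMap _ L f ^ k = θ b * algebraMap _ L f ^ k) : a = b :=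
  hθ.injective (((IsLocalization.Away.algebraMap_isUnit f).pow k).mul_left_injective h)

/-- The functions `xᵢ xⱼ / f`. -/
lemma IsDegreeZeroPart.exists_products [IsLocalization.Away f L]
    (hθ : IsDegreeZeroPart f θ) : ∃ Z : ι → ι → R, ∀ i j,
    θ (Z i j) * algebraMap _ L f = genericVec K L i * genericVec K L j := by
  have h : ∀ i j : ι, ∃ z : R,
      θ z * algebraMap _ L f = genericVec K L i * genericVec K L j := by
    intro i j
    obtain ⟨z, hz⟩ : ∃ z : L, z * algebraMap _ L f = genericVec K L i * genericVec K L j := by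
      obtain ⟨b, hb⟩ := (IsLocalization.Away.algebraMap_isUnit (S := L) f).exists_left_inv
      exact ⟨genericVec K L i * genericVec K L j * b, by rw [mul_assoc, hb, mul_one]⟩
    obtain ⟨r, rfl⟩ : z ∈ θ.range := (hθ.mem_range_iff z).2
      ⟨1, MvPolynomial.X i * MvPolynomial.X j,
        (MvPolynomial.isHomogeneous_X K i).mul (MvPolynomial.isHomogeneous_X K j), by
        rw [pow_one, hz, map_mul]; rfl⟩
    exact ⟨r, hz⟩
  choose Z hZ using h
  exact ⟨Z, hZ⟩

variable [IsScalarTower K (MvPolynomial ι K) L]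

/-- A homomorphism `g` out of `K[x]_f` with `g f = 1` sends the fraction `p / fᵏ` to `g p`. -/
lemma map_eq_aeval_of_mul_pow_eq {S : Type*} [CommRing S] [Algebra K S] {g : L →ₐ[K] S}
    (hg : MvPolynomial.aeval (g ∘ (genericVec K L : ι → L)) f = 1) {z : L} {k : ℕ}
    {p : MvPolynomial ι K} (h : z * algebraMap _ L f ^ k = algebraMap _ L p) :
    g z = MvPolynomial.aeval (g ∘ (genericVec K L : ι → L)) p := by
  have hq : ∀ q : MvPolynomial ι K,
      g (algebraMap _ L q) = MvPolynomial.aeval (g ∘ (genericVec K L : ι → L)) q := fun q => by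
    rw [← aeval_genericVec, MvPolynomial.comp_aeval_apply]; rfl
  rw [← hq, ← h, map_mul, map_pow, hq, hg, one_pow, mul_one]

namespace IsDegreeZeroPart

variable [IsLocalization.Away f L]

/-- Dehomogenization: for `r = p / fᵏ`, substituting `xᵢ xⱼ / f` for `xⱼ` in `p` multiplies `r` by
`(xᵢ² / f)ᵏ`. -/
lemma aeval_products (hθ : IsDegreeZeroPart f θ) {Z : ι → ι → R} (hZ : ∀ i j,
    θ (Z i j) * algebraMap _ L f = genericVec K L i * genericVec K L j) {r : R} {k : ℕ}
    {p : MvPolynomial ι K} (hp : p.IsHomogeneous (2 * k))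
    (h : θ r * algebraMap _ L f ^ k = algebraMap _ L p) (i : ι) :
    MvPolynomial.aeval (Z i) p = Z i i ^ k * r := by
  apply hθ.eq_of_mul_eq (2 * k)
  have h1 : algebraMap _ L f • (θ ∘ Z i) = genericVec K L i • genericVec K L := by
    ext j
    simp only [Pi.smul_apply, smul_eq_mul, Function.comp_apply, ← hZ]
    ring
  have h2 := aeval_smul_of_isHomogeneous hp (algebraMap _ L f) (θ ∘ Z i)
  rw [h1, aeval_smul_of_isHomogeneous hp, aeval_genericVec, ← h, pow_mul _ 2, pow_two, ← hZ] at h2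
  have h3 : θ (MvPolynomial.aeval (Z i) p) = MvPolynomial.aeval (θ ∘ Z i) p :=
    MvPolynomial.comp_aeval_apply _ _ _
  rw [h3, mul_comm, ← h2, map_mul, map_pow, mul_pow]
  ring

variable [Fintype ι] [DecidableEq ι] {G : Matrix ι ι K}

/-- The points of the complement of a quadric over an algebraically closed field: each has a
representative `v` with `f(v) = 1`, and `p / fᵏ` has the value `p(v)` there. -/
lemma exists_vector [IsAlgClosed K] (hθ : IsDegreeZeroPart f θ)
    (hGf : baseForm G (MvPolynomial ι K) MvPolynomial.X MvPolynomial.X = f) (e : R →ₐ[K] K) :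
    ∃ v : ι → K, MvPolynomial.aeval v f = 1 ∧
      ∀ (r : R) (k : ℕ) (p : MvPolynomial ι K), p.IsHomogeneous (2 * k) →
        θ r * algebraMap _ L f ^ k = algebraMap _ L p → e r = MvPolynomial.aeval v p := by
  obtain ⟨Z, hZ⟩ := hθ.exists_products
  have hsq : ∀ i j, Z i j ^ 2 = Z i i * Z j j := fun i j => by
    apply hθ.eq_of_mul_eq 2
    simp only [map_mul, map_pow]
    linear_combination (θ (Z i j) * algebraMap _ L f + genericVec K L i * genericVec K L j) *
      hZ i j - θ (Z j j) * algebraMap _ L f * hZ i i - genericVec K L i ^ 2 * hZ j j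
  have hone : (1 : R) = ∑ i, ∑ j, algebraMap K R (G i j) * Z i j := by
    apply hθ.eq_of_mul_eq 1
    have h : algebraMap _ L f =
        ∑ i, ∑ j, genericVec K L i * algebraMap K L (G i j) * genericVec K L j := by
      rw [← aeval_genericVec, aeval_eq_baseForm hGf, baseForm, Matrix.toBilin'_apply]
      rfl
    rw [map_one, one_mul, pow_one, map_sum, Finset.sum_mul]
    conv_lhs => rw [h]
    refine Finset.sum_congr rfl fun i _ => ?_
    rw [map_sum, Finset.sum_mul]
    refine Finset.sum_congr rfl fun j _ => ?_
    rw [map_mul, θ.commutes]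
    linear_combination (-algebraMap K L (G i j)) * hZ i j
  obtain ⟨i, hi⟩ : ∃ i, e (Z i i) ≠ 0 := by
    by_contra! H
    have h0 : ∀ i j, e (Z i j) = 0 := fun i j => by
      have := congrArg e (hsq i j)
      rw [map_pow, map_mul, H, zero_mul] at this
      exact pow_eq_zero_iff two_ne_zero |>.1 this
    have := congrArg e hone
    simp [h0] at this
  -- `e (xᵢ² / f)` is to be `vᵢ²`; its square root `s` is `vᵢ`, and `vⱼ = e (xᵢ xⱼ / f) / s`
  obtain ⟨s, hs⟩ := IsAlgClosed.exists_pow_nat_eq (e (Z i i)) (n := 2) (by norm_num)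
  have hs0 : s ≠ 0 := by rintro rfl; exact hi (by rw [← hs]; simp)
  have key : ∀ (r : R) (k : ℕ) (p : MvPolynomial ι K), p.IsHomogeneous (2 * k) →
      θ r * algebraMap _ L f ^ k = algebraMap _ L p →
      e r = MvPolynomial.aeval (s⁻¹ • (e ∘ Z i)) p := by
    intro r k p hp h
    have h1 := congrArg e (hθ.aeval_products hZ hp h i)
    rw [MvPolynomial.comp_aeval_apply, map_mul, map_pow, ← hs, ← pow_mul] at h1
    rw [aeval_smul_of_isHomogeneous hp]
    have h2 : MvPolynomial.aeval (e ∘ Z i) p = s ^ (2 * k) * e r := h1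
    rw [h2, ← mul_assoc, ← mul_pow, inv_mul_cancel₀ hs0, one_pow, one_mul]
  refine ⟨_, ?_, key⟩
  have hf : f.IsHomogeneous 2 := by
    rw [← hGf, baseForm, Matrix.toBilin'_apply]
    refine MvPolynomial.IsHomogeneous.sum _ _ _ fun i _ =>
      MvPolynomial.IsHomogeneous.sum _ _ _ fun j _ => ?_
    exact ((MvPolynomial.isHomogeneous_X K i).mul (MvPolynomial.isHomogeneous_C _ _)).mul
      (MvPolynomial.isHomogeneous_X K j)
  rw [← key 1 1 f hf (by simp), map_one]

/-- The Eichler transformations of the quadratic form act on the complement of the quadric. -/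
lemma exists_eichlerCoaction [CharZero K] (hθ : IsDegreeZeroPart f θ) (hG : G.IsSymm)
    (hGf : baseForm G (MvPolynomial ι K) MvPolynomial.X MvPolynomial.X = f)
    {u w : ι → K} (hu : baseForm G K u u = 0) (huw : baseForm G K u w = 0) :
    ∃ ρ : GaCoaction K R, ∀ r, (ρ.toAlgHom r).map (θ : R →+* L) =
      (eichlerCoaction L hG hGf hu huw).toAlgHom (θ r) := by
  refine GaCoaction.exists_restrict _ θ hθ.injective fun r m => ?_
  obtain ⟨k, p, hp, h⟩ := (hθ.mem_range_iff (θ r)).1 ⟨r, rfl⟩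
  rw [hθ.mem_range_iff]
  let y : ι → L[X] := eichler G u w X (C ∘ (genericVec K L : ι → L))
  set E := (eichlerCoaction L hG hGf hu huw).toAlgHom with hEdef
  have hE : E ∘ genericVec K L = y := eichlerCoaction_apply_genericVec hG hGf hu huw
  have hq : ∀ q : MvPolynomial ι K, E (algebraMap _ L q) = MvPolynomial.aeval y q := fun q => by
    rw [← aeval_genericVec, MvPolynomial.comp_aeval_apply, ← hE]; rfl
  have hf : MvPolynomial.aeval y f = C (algebraMap _ L f) := by
    rw [aeval_eq_baseForm hGf, baseForm_eichler hG hu huw, ← aeval_genericVec (L := L) f,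
      aeval_eq_baseForm hGf]
    exact (map_baseForm G (CAlgHom (R := K) (A := L)) _ _).symm
  -- the components of `y` are polynomials in `t` with linear forms as coefficients
  have h01 : ∀ {a b : L[X]}, a ∈ formPolys K ι L 0 → b ∈ formPolys K ι L 1 →
      a * b ∈ formPolys K ι L 1 := fun ha hb => by
    simpa using SetLike.mul_mem_graded ha hb
  have hconst : ∀ c : K, algebraMap K L[X] c ∈ formPolys K ι L 0 := fun c => by
    rw [Algebra.algebraMap_eq_smul_one]
    exact Submodule.smul_mem _ _ SetLike.GradedOne.one_mem
  have hX : (X : L[X]) ∈ formPolys K ι L 0 := fun m => by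
    rw [coeff_X]
    split_ifs
    · exact ⟨1, MvPolynomial.isHomogeneous_one _ _, map_one _⟩
    · exact ⟨0, MvPolynomial.isHomogeneous_zero _ _ _, map_zero _⟩
  have hgen : ∀ i, C (genericVec K L i) ∈ formPolys K ι L 1 := fun i m => by
    rw [coeff_C]
    split_ifs
    · exact ⟨MvPolynomial.X i, MvPolynomial.isHomogeneous_X _ _, rfl⟩
    · exact ⟨0, MvPolynomial.isHomogeneous_zero _ _ _, map_zero _⟩
  have hβ : ∀ a : ι → K, baseForm G L[X] (baseVec L[X] a) (C ∘ (genericVec K L : ι → L)) ∈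
      formPolys K ι L 1 := fun a => by
    rw [baseForm, Matrix.toBilin'_apply]
    refine Submodule.sum_mem _ fun i _ => Submodule.sum_mem _ fun j _ => h01 ?_ (hgen j)
    rw [Matrix.map_apply, baseVec, ← map_mul]
    exact hconst _
  have hy : ∀ i, y i ∈ formPolys K ι L 1 := fun i => by
    have hi : y i = C (genericVec K L i) +
        X * (algebraMap K L[X] (w i) *
            baseForm G L[X] (baseVec L[X] u) (C ∘ (genericVec K L : ι → L)) -
          algebraMap K L[X] (u i) *
            baseForm G L[X] (baseVec L[X] w) (C ∘ (genericVec K L : ι → L))) -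
        X * (X * (algebraMap K L[X] (1 / 2 * baseForm G K w w * u i) *
          baseForm G L[X] (baseVec L[X] u) (C ∘ (genericVec K L : ι → L)))) := by
      simp only [y, eichler, Pi.add_apply, Pi.sub_apply, Pi.smul_apply, smul_eq_mul,
        Function.comp_apply, baseForm_baseVec, map_mul, baseVec]
      ring
    rw [hi]
    exact sub_mem (add_mem (hgen i) (h01 hX (sub_mem (h01 (hconst _) (hβ u))
      (h01 (hconst _) (hβ w))))) (h01 hX (h01 hX (h01 (hconst _) (hβ u))))
  obtain ⟨p', hp', h'⟩ := aeval_mem_formPolys hy hp m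
  refine ⟨k, p', hp', ?_⟩
  have h2 := congrArg E h
  rw [map_mul, map_pow, hq, hq, hf, ← C_pow] at h2
  rw [h', ← h2, coeff_mul_C]

/-- The derivation of the action of the Eichler transformations, at the point `v`. -/
lemma eval_coeff_one [CharZero K] (hG : G.IsSymm)
    (hGf : baseForm G (MvPolynomial ι K) MvPolynomial.X MvPolynomial.X = f)
    {u w : ι → K} (hu : baseForm G K u u = 0) (huw : baseForm G K u w = 0)
    {ρ : GaCoaction K R} (hρ : ∀ r, (ρ.toAlgHom r).map (θ : R →+* L) =
      (eichlerCoaction L hG hGf hu huw).toAlgHom (θ r)) {v : ι → K}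
    (hv : MvPolynomial.aeval v f = 1) {r : R} {k : ℕ} {p : MvPolynomial ι K}
    (h : θ r * algebraMap _ L f ^ k = algebraMap _ L p) :
    evalAt L (hv ▸ isUnit_one : IsUnit (MvPolynomial.aeval v f)) (θ ((ρ.toAlgHom r).coeff 1)) =
      ∑ i, MvPolynomial.aeval v (MvPolynomial.pderiv i p) *
        (baseForm G K u v • w - baseForm G K w v • u) i := by
  set ev := evalAt L (hv ▸ isUnit_one : IsUnit (MvPolynomial.aeval v f)) with hev
  set E := (eichlerCoaction L hG hGf hu huw).toAlgHom with hEdef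
  have hE : E ∘ genericVec K L = eichler G u w X (C ∘ (genericVec K L : ι → L)) :=
    eichlerCoaction_apply_genericVec hG hGf hu huw
  let g : L →ₐ[K] K[X] := (mapAlgHom ev).comp E
  have hCv : (mapAlgHom ev) ∘ C ∘ (genericVec K L : ι → L) = CAlgHom (R := K) ∘ v := by
    ext1 i
    have := congrFun (evalAt_comp_genericVec (L := L)
      (hv ▸ isUnit_one : IsUnit (MvPolynomial.aeval v f))) i
    simp only [Function.comp_apply] at this ⊢
    rw [← hev] at this
    simp [this]
  have hg : g ∘ genericVec K L = eichler G u w X (CAlgHom (R := K) ∘ v) := by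
    change (mapAlgHom ev) ∘ E ∘ genericVec K L = _
    rw [hE, map_eichler, hCv]
    simp
  have hgf : MvPolynomial.aeval (g ∘ genericVec K L) f = 1 := by
    rw [hg, aeval_eq_baseForm hGf, baseForm_eichler hG hu huw, ← map_baseForm,
      ← aeval_eq_baseForm hGf, hv, map_one]
  have h1 : g (θ r) = MvPolynomial.aeval (g ∘ genericVec K L) p := map_eq_aeval_of_mul_pow_eq hgf h
  have h2 : ev (θ ((ρ.toAlgHom r).coeff 1)) = (g (θ r)).coeff 1 := by
    change _ = ((E (θ r)).map (ev : L →+* K)).coeff 1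
    rw [← hρ, coeff_map, coeff_map]
    rfl
  have hβ : ∀ a : ι → K, baseForm G K[X] (baseVec K[X] a) (CAlgHom (R := K) ∘ v) =
      C (baseForm G K a v) := fun a => by
    have := map_baseForm G (CAlgHom (R := K) (A := K)) a v
    exact this.symm
  have hi : ∀ i, eichler G u w X (CAlgHom (R := K) ∘ v) i = C (v i) +
      X * (C ((baseForm G K u v • w - baseForm G K w v • u) i) -
        X * C (1 / 2 * baseForm G K w w * baseForm G K u v * u i)) := fun i => by
    simp only [eichler, Pi.add_apply, Pi.sub_apply, Pi.smul_apply, smul_eq_mul,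
      Function.comp_apply, baseForm_baseVec, map_mul, map_sub, hβ, baseVec]
    simp only [Polynomial.algebraMap_eq, CAlgHom_apply]
    ring
  rw [h2, h1, hg, coeff_one_aeval]
  have hc0 : ∀ i, (eichler G u w X (CAlgHom (R := K) ∘ v) i : K[X]).coeff 0 = v i := fun i => by
    rw [hi]; simp
  have hc1 : ∀ i, (eichler G u w X (CAlgHom (R := K) ∘ v) i : K[X]).coeff 1 =
      (baseForm G K u v • w - baseForm G K w v • u) i := fun i => by
    rw [hi, coeff_add, coeff_C, coeff_X_mul]; simp
  simp only [hc0, hc1]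

/-- The cotangent space at a point of the complement of a quadric of rank at least three contains
no nonzero vector that is killed by the velocities of all `𝔾ₐ`-actions. -/
lemma exists_mul_mem_sq [IsAlgClosed K] [CharZero K] [Algebra.FiniteType K R]
    (hθ : IsDegreeZeroPart f θ) (hG : G.IsSymm)
    (hGf : baseForm G (MvPolynomial ι K) MvPolynomial.X MvPolynomial.X = f) (hrank : 3 ≤ G.rank)
    (I : Ideal R) (hI : I.IsMaximal) (r : R) (hr : r ∈ I)
    (H : ∀ ρ : GaCoaction K R, (ρ.toAlgHom r).coeff 1 ∈ I) : ∃ s ∉ I, s * r ∈ I ^ 2 := by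
  -- the point `e` with the ideal `I`, by the Nullstellensatz
  obtain ⟨e, he⟩ : ∃ e : R →ₐ[K] K, ∀ r, e r = 0 ↔ r ∈ I := by
    let _ : Field (R ⧸ I) := Ideal.Quotient.field I
    have : Module.Finite K (R ⧸ I) := finite_of_finite_type_of_isJacobsonRing K (R ⧸ I)
    let φ : K ≃ₐ[K] (R ⧸ I) := AlgEquiv.ofBijective (Algebra.ofId K _)
      (IsAlgClosed.algebraMap_bijective_of_isIntegral (k := K) (K := R ⧸ I))
    refine ⟨(φ.symm : (R ⧸ I) →ₐ[K] K).comp (Ideal.Quotient.mkₐ K I), fun r => ?_⟩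
    rw [← Ideal.Quotient.eq_zero_iff_mem]
    exact map_eq_zero_iff φ.symm φ.symm.injective
  obtain ⟨v, hv, hev⟩ := hθ.exists_vector hGf e
  obtain ⟨k, p, hp, h⟩ := (hθ.mem_range_iff (θ r)).1 ⟨r, rfl⟩
  have hpv : MvPolynomial.aeval v p = 0 := by rw [← hev r k p hp h, he]; exact hr
  have hβv : baseForm G K v v = 1 := by rw [← aeval_eq_baseForm hGf, hv]
  have hevθ : ∀ a, evalAt L (hv ▸ isUnit_one : IsUnit (MvPolynomial.aeval v f)) (θ a) = e a := by
    intro a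
    obtain ⟨k, q, hq, h⟩ := (hθ.mem_range_iff (θ a)).1 ⟨a, rfl⟩
    have hgen := evalAt_comp_genericVec (L := L)
      (hv ▸ isUnit_one : IsUnit (MvPolynomial.aeval v f))
    rw [hev a k q hq h, map_eq_aeval_of_mul_pow_eq (by rw [hgen, hv]) h, hgen]
  -- the differential of `p` at `v`
  let l : (ι → K) →ₗ[K] K :=
    ∑ i, MvPolynomial.aeval v (MvPolynomial.pderiv i p) • LinearMap.proj i
  have hl : ∀ z, l z = ∑ i, MvPolynomial.aeval v (MvPolynomial.pderiv i p) * z i := fun z => by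
    simp [l, LinearMap.sum_apply]
  have hl0 : l = 0 := by
    refine eq_zero_of_eichler_velocity hG hrank hβv l ?_ fun u w hu huw => ?_
    · have := congrArg (MvPolynomial.aeval v) hp.sum_X_mul_pderiv
      rw [map_nsmul, hpv, smul_zero, map_sum] at this
      rw [hl, ← this]
      exact Finset.sum_congr rfl fun i _ => by rw [map_mul, MvPolynomial.aeval_X, mul_comm]
    · obtain ⟨ρ, hρ⟩ := hθ.exists_eichlerCoaction hG hGf hu huw
      rw [hl, ← eval_coeff_one hG hGf hu huw hρ hv h, hevθ, he]
      exact H ρ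
  have hder : ∀ i, MvPolynomial.aeval v (MvPolynomial.pderiv i p) = 0 := fun i => by
    have := hl (Pi.single i 1)
    rw [hl0] at this
    simpa [Pi.single_apply] using this.symm
  -- the affine coordinates `xⱼ / xᵢ`, up to a unit at the point `e`
  obtain ⟨i, hi⟩ : ∃ i, v i ≠ 0 := by
    by_contra! H0
    have : v = 0 := funext H0
    simp [this] at hβv
  obtain ⟨Z, hZ⟩ := hθ.exists_products
  have heZ : ∀ j, e (Z i j) = v i * v j := fun j => by
    rw [hev (Z i j) 1 (MvPolynomial.X i * MvPolynomial.X j)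
      ((MvPolynomial.isHomogeneous_X K i).mul (MvPolynomial.isHomogeneous_X K j))
      (by rw [pow_one, hZ, map_mul]; rfl)]
    simp
  let c : R := algebraMap K R (v i)⁻¹
  refine ⟨c ^ (2 * k) * Z i i ^ k, ?_, ?_⟩
  · rw [← he]
    simp [c, heZ, hi]
  · have hT := aeval_sub_taylor_mem_sq I v (c • Z i) (fun j => by
      rw [← he]
      simp [c, heZ, hi]) p
    simp only [hder, hpv, map_zero, zero_mul, Finset.sum_const_zero, sub_zero] at hT
    rwa [aeval_smul_of_isHomogeneous hp, hθ.aeval_products hZ hp h, ← mul_assoc] at hT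

end IsDegreeZeroPart

end

end Polynomials

/-! ### The complement as an affine scheme -/

section Complement

attribute [local instance] MvPolynomial.gradedAlgebra

variable {K : Type u} [Field K] {n : ℕ} {f : MvPolynomial (Fin (n + 1)) K}

lemma gramMatrix_isSymm (f : MvPolynomial (Fin (n + 1)) K) : (gramMatrix f).IsSymm := by
  ext i j
  simp only [Matrix.transpose_apply, gramMatrix, Matrix.of_apply, eq_comm (a := j) (b := i)]
  rw [add_comm (Finsupp.single j 1)]

/-- A quadratic form is given by its symmetric matrix; this is Euler's identity, applied twice. -/
lemma baseForm_gramMatrix [CharZero K] (hf : f.IsHomogeneous 2) :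
    baseForm (gramMatrix f) (MvPolynomial (Fin (n + 1)) K) MvPolynomial.X MvPolynomial.X = f := by
  have hG : ∀ i j, MvPolynomial.pderiv j (MvPolynomial.pderiv i f) =
      MvPolynomial.C (2 * gramMatrix f i j) := by
    intro i j
    have h0 : (MvPolynomial.pderiv j (MvPolynomial.pderiv i f)).IsHomogeneous 0 :=
      hf.pderiv.pderiv
    rw [← MvPolynomial.totalDegree_zero_iff_isHomogeneous,
      MvPolynomial.totalDegree_eq_zero_iff_eq_C] at h0
    rw [h0, MvPolynomial.coeff_pderiv, MvPolynomial.coeff_pderiv, gramMatrix, Matrix.of_apply]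
    congr 1
    rw [zero_add, add_comm (Finsupp.single j 1)]
    by_cases hij : i = j
    · subst hij; simp; ring
    · simp [hij]
  have h1 := hf.sum_X_mul_pderiv
  have h2 : ∀ i, ∑ j, MvPolynomial.X j * MvPolynomial.pderiv j (MvPolynomial.pderiv i f) =
      MvPolynomial.pderiv i f := fun i => by
    have := (hf.pderiv (i := i)).sum_X_mul_pderiv
    rwa [show 2 - 1 = 1 from rfl, one_smul] at this
  have htwo : (2 : MvPolynomial (Fin (n + 1)) K) ≠ 0 := two_ne_zero
  apply mul_left_cancel₀ htwo
  rw [nsmul_eq_mul, Nat.cast_ofNat] at h1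
  rw [← h1, baseForm, Matrix.toBilin'_apply, Finset.mul_sum]
  refine Finset.sum_congr rfl fun i _ => ?_
  rw [← h2, Finset.mul_sum, Finset.mul_sum]
  refine Finset.sum_congr rfl fun j _ => ?_
  rw [hG, Matrix.map_apply, MvPolynomial.algebraMap_eq, map_mul, map_ofNat]
  ring

lemma complement_eq_basicOpen (f : MvPolynomial (Fin (n + 1)) K) :
    complement f = Proj.basicOpen (MvPolynomial.homogeneousSubmodule (Fin (n + 1)) K) f := by
  ext x
  change ¬ (({f} : Set (MvPolynomial (Fin (n + 1)) K)) ⊆ _) ↔ _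
  rw [Set.singleton_subset_iff]
  rfl

variable (f) in
/-- The ring of functions on the complement: the fractions `p / fᵏ` of degree zero. -/
abbrev awayRing : CommRingCat.{u} :=
  CommRingCat.of (HomogeneousLocalization.Away
    (MvPolynomial.homogeneousSubmodule (Fin (n + 1)) K) f)

/-- The complement of a quadric is the spectrum of the ring of fractions of degree zero. -/
def complementIso (hf : f ∈ MvPolynomial.homogeneousSubmodule (Fin (n + 1)) K 2) : (complement f).toScheme ≅ Spec (awayRing f) :=
  Scheme.isoOfEq _ (complement_eq_basicOpen f) ≪≫ Proj.basicOpenIsoSpec _ f hf two_pos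

variable (f) in
/-- The constants in the ring of functions on the complement. -/
def constAway : CommRingCat.of K ⟶ awayRing f :=
  CommRingCat.ofHom
      (algebraMap K (MvPolynomial.homogeneousSubmodule (Fin (n + 1)) K 0)) ≫
    CommRingCat.ofHom (HomogeneousLocalization.fromZeroRingHom _ _)

lemma complementIso_hom_comp (hf : f ∈ MvPolynomial.homogeneousSubmodule (Fin (n + 1)) K 2) :
    (complementIso hf).hom ≫ Spec.map (constAway f) = complementToSpec f := by
  rw [constAway, Spec.map_comp, ← Proj.awayι_toSpecZero _ f hf two_pos, complementIso,
    ← Proj.basicOpenIsoSpec_inv_ι, complementToSpec, projectiveSpaceToSpec]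
  simp

/-- The functions on the complement are the fractions of degree zero. -/
def sectionsEquiv (hf : f ∈ MvPolynomial.homogeneousSubmodule (Fin (n + 1)) K 2) : Γ((complement f).toScheme, ⊤) ≃+* awayRing f :=
  (Scheme.Γ.mapIso (complementIso hf).symm.op ≪≫ Scheme.ΓSpecIso (awayRing f)).commRingCatIsoToRingEquiv

lemma sectionsEquiv_constSection (hf : f ∈ MvPolynomial.homogeneousSubmodule (Fin (n + 1)) K 2) (c : K) :
    sectionsEquiv hf (constSection (complementToSpec f) c) = (constAway f).hom c := by
  have h : (Scheme.ΓSpecIso (CommRingCat.of K)).inv ≫ (complementToSpec f).appTop ≫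
      (complementIso hf).inv.appTop ≫ (Scheme.ΓSpecIso (awayRing f)).hom = constAway f := by
    rw [← Scheme.Hom.comp_appTop_assoc, ← complementIso_hom_comp hf, Iso.inv_hom_id_assoc,
      Scheme.ΓSpecIso_naturality, Iso.inv_hom_id_assoc]
  exact congrArg (fun g : CommRingCat.of K ⟶ awayRing f => g.hom c) h

lemma isAffine_complement (hf : f ∈ MvPolynomial.homogeneousSubmodule (Fin (n + 1)) K 2) : IsAffine (complement f).toScheme :=
  .of_isIso (complementIso hf).hom

lemma locallyOfFiniteType_complementToSpec (f : MvPolynomial (Fin (n + 1)) K) :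
    LocallyOfFiniteType (complementToSpec f) := by
  have h0 : IsScalarTower K (MvPolynomial.homogeneousSubmodule (Fin (n + 1)) K 0)
      (MvPolynomial (Fin (n + 1)) K) :=
    ⟨fun c x y => smul_mul_assoc c (x : MvPolynomial (Fin (n + 1)) K) y⟩
  have h1 : Algebra.FiniteType (MvPolynomial.homogeneousSubmodule (Fin (n + 1)) K 0)
      (MvPolynomial (Fin (n + 1)) K) :=
    Algebra.FiniteType.of_restrictScalars_finiteType K _ _
  have h2 : LocallyOfFiniteType (Spec.map (CommRingCat.ofHom
      (algebraMap K (MvPolynomial.homogeneousSubmodule (Fin (n + 1)) K 0)))) := by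
    rw [HasRingHomProperty.Spec_iff (P := @LocallyOfFiniteType)]
    refine RingHom.FiniteType.of_surjective _ ?_
    rintro ⟨q, hq⟩
    rw [MvPolynomial.mem_homogeneousSubmodule, ← MvPolynomial.totalDegree_zero_iff_isHomogeneous,
      MvPolynomial.totalDegree_eq_zero_iff_eq_C] at hq
    exact ⟨q.coeff 0, Subtype.ext hq.symm⟩
  rw [complementToSpec, projectiveSpaceToSpec]
  infer_instance

/-- The functions on the complement, as a `K`-algebra. -/
abbrev sectionsAlgebra (f : MvPolynomial (Fin (n + 1)) K) :
    Algebra K Γ((complement f).toScheme, ⊤) :=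
  ((complementToSpec f).appTop.hom.comp
    (Scheme.ΓSpecIso (CommRingCat.of K)).inv.hom).toAlgebra

attribute [local instance] sectionsAlgebra

lemma finiteType_sections (hf : f ∈ MvPolynomial.homogeneousSubmodule (Fin (n + 1)) K 2) :
    Algebra.FiniteType K Γ((complement f).toScheme, ⊤) := by
  have := isAffine_complement hf
  have h := HasRingHomProperty.appTop @LocallyOfFiniteType _
    (locallyOfFiniteType_complementToSpec f)
  refine RingHom.FiniteType.comp h (RingHom.FiniteType.of_surjective _ ?_)
  exact (Scheme.ΓSpecIso (CommRingCat.of K)).symm.commRingCatIsoToRingEquiv.surjective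

/-- The functions on the complement, as elements of `K[x]_f`. -/
def sectionsToLocalization (hf : f ∈ MvPolynomial.homogeneousSubmodule (Fin (n + 1)) K 2) :
    Γ((complement f).toScheme, ⊤) →ₐ[K] Localization.Away f where
  toRingHom := (algebraMap (awayRing f) (Localization.Away f)).comp
    (sectionsEquiv hf : Γ((complement f).toScheme, ⊤) →+* awayRing f)
  commutes' c := by
    change algebraMap (awayRing f) (Localization.Away f)
      (sectionsEquiv hf (constSection (complementToSpec f) c)) = _
    rw [sectionsEquiv_constSection]
    change Localization.mk _ _ = _
    rw [IsScalarTower.algebraMap_apply K (MvPolynomial (Fin (n + 1)) K) (Localization.Away f)]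
    exact Localization.mk_one_eq_algebraMap _

lemma isDegreeZeroPart_sections (hf : f ∈ MvPolynomial.homogeneousSubmodule (Fin (n + 1)) K 2) :
    IsDegreeZeroPart f (sectionsToLocalization hf) where
  injective := (HomogeneousLocalization.val_injective _).comp (sectionsEquiv hf).injective
  mem_range_iff z := by
    constructor
    · rintro ⟨r, rfl⟩
      obtain ⟨k, p, hp, h⟩ := HomogeneousLocalization.Away.mk_surjective
        (MvPolynomial.homogeneousSubmodule (Fin (n + 1)) K) hf (sectionsEquiv hf r)
      refine ⟨k, p, by rwa [smul_eq_mul, mul_comm] at hp, ?_⟩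
      change HomogeneousLocalization.val (sectionsEquiv hf r) * _ = _
      rw [← h, HomogeneousLocalization.Away.val_mk, Localization.mk_eq_mk', ← map_pow]
      exact IsLocalization.mk'_spec _ p (⟨f ^ k, k, rfl⟩ : Submonoid.powers f)
    · rintro ⟨k, p, hp, h⟩
      refine ⟨(sectionsEquiv hf).symm (HomogeneousLocalization.Away.mk _ hf k p
        (by rwa [smul_eq_mul, mul_comm])), ?_⟩
      change HomogeneousLocalization.val (sectionsEquiv hf ((sectionsEquiv hf).symm _)) = z
      rw [RingEquiv.apply_symm_apply, HomogeneousLocalization.Away.val_mk, Localization.mk_eq_mk']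
      rw [IsLocalization.mk'_eq_iff_eq_mul, ← h, map_pow]

lemma isDomain_sections (hf : f ∈ MvPolynomial.homogeneousSubmodule (Fin (n + 1)) K 2) (hf0 : f ≠ 0) :
    IsDomain Γ((complement f).toScheme, ⊤) := by
  have : IsDomain (Localization.Away f) := IsLocalization.isDomain_localization
    (powers_le_nonZeroDivisors_of_noZeroDivisors hf0)
  exact (isDegreeZeroPart_sections hf).injective.isDomain (sectionsToLocalization hf).toRingHom

lemma isVariety_complement (hf : f ∈ MvPolynomial.homogeneousSubmodule (Fin (n + 1)) K 2) (hf0 : f ≠ 0) :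
    IsVariety (complementToSpec f) := by
  have := isAffine_complement hf
  have := isDomain_sections hf hf0
  have : Nonempty (complement f).toScheme :=
    ⟨(complement f).toScheme.isoSpec.inv (Classical.arbitrary
      (PrimeSpectrum Γ((complement f).toScheme, ⊤)))⟩
  exact ⟨isIntegral_of_isAffine_of_isDomain _, inferInstance,
    locallyOfFiniteType_complementToSpec f, inferInstance⟩

lemma quadricRank_zero : quadricRank (0 : MvPolynomial (Fin (n + 1)) K) = 0 := by
  have : gramMatrix (0 : MvPolynomial (Fin (n + 1)) K) = 0 := by ext; simp [gramMatrix]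
  rw [quadricRank, this, Matrix.rank_zero]

lemma isFlexible_complement [IsAlgClosed K] [CharZero K] (hf : f.IsHomogeneous 2)
    (hf0 : f ≠ 0) (hrank : 3 ≤ quadricRank f) : IsFlexible (complementToSpec f) := by
  have := isAffine_complement hf
  have := isDomain_sections hf hf0
  have := finiteType_sections hf
  have : IsNoetherianRing Γ((complement f).toScheme, ⊤) :=
    Algebra.FiniteType.isNoetherianRing K _
  exact isFlexible_of_coactions (fun _ => rfl) fun I hI r hr H =>
    (isDegreeZeroPart_sections hf).exists_mul_mem_sq (gramMatrix_isSymm f)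
      (baseForm_gramMatrix hf) hrank I hI r hr H

end Complement

end QuadricComplement

end

theorem theorem5 {K : Type u} [Field K] [IsAlgClosed K] [CharZero K] (n : ℕ)
    (f : MvPolynomial (Fin (n + 1)) K) (hf : f.IsHomogeneous 2)
    (hrank : 3 ≤ QuadricComplement.quadricRank f) :
    IsAffine (QuadricComplement.complement f).toScheme ∧
      QuadricComplement.IsVariety (QuadricComplement.complementToSpec f) ∧
      QuadricComplement.IsFlexible (QuadricComplement.complementToSpec f) := by
  have hf0 : f ≠ 0 := by
    rintro rfl
    exact absurd hrank (by rw [QuadricComplement.quadricRank_zero]; norm_num)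
  exact ⟨QuadricComplement.isAffine_complement hf,
    QuadricComplement.isVariety_complement hf hf0,
    QuadricComplement.isFlexible_complement hf hf0 hrank⟩
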